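/- Let $K$ be a non-degenerate triangulation of a closed 4-manifold, that is, a finite (abstract) simplicial complex in which the link of every vertex is a combinatorial 3-sphere (a complex related to the boundary of the 4-simplex by a finite chain of stellar subdivisions and their inverses). Let $\Delta$ be its dual 2-skeleton, with vertex set $V$ (the 4-simplices of $K$), edge set $E$ (the tetrahedra) and face set $F$ (the triangles); incidence in $\Delta$ is reversed inclusion in $K$. For $f\in F$ let $\deg_V(f)$ and $\deg_E(f)$ be the numbers of 4-simplices and of tetrahedra containing $f$, and for $e\in E$ put $\alpha_e=\sum_{f\ni e}\bigl(1-\tfrac{3}{\deg_V(f)+\deg_E(f)}\bigr)$, the sum being over the four triangles of $e$. Let $H_+^3=\{x\in\mathbb R^4: x\cdot x=1,\ x_0>0\}$ for the Minkowski product $x\cdot y=x_0y_0-x_1y_1-x_2y_2-x_3y_3$, with invariant measure $dx=dx_1dx_2dx_3/x_0$ and distance $\phi(x,y)=\cosh^{-1}(x\cdot y)$, and put $K_p(x,y)=\frac{\sin(p\,\phi(x,y))}{p\sinh\phi(x,y)}$. For each $v\in V$ choose an edge $e_0^v\ni v$ and a point of $H_+^3$ at which the variable $x_{(e_0^v,v)}$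 is fixed, and for $f\ni v$ let $e_\pm(f,v)$ be the two edges containing $v$ and contained in $f$ (labelled in any way); write $\phi_{f,v}=\phi(x_{(e_+(f,v),v)},x_{(e_-(f,v),v)})$. For $p\in(0,\infty)^F$ the Perez–Rovelli amplitudes are $\mathcal A_f=1$, $$\mathcal A_e=\frac{2}{\pi\prod_{f\ni e}p_f}\int_0^\infty\frac{\prod_{f\ni e}\sin(p_fr_e)}{\sinh^2 r_e}\,dr_e,\qquad \mathcal A_v=\int_{(H_+^3)^4}\prod_{f\ni v}K_{p_f}\bigl(x_{(e_+(f,v),v)},x_{(e_-(f,v),v)}\bigr)\prod_{e\ni v,\,e\ne e_0^v}dx_{(e,v)},$$ and $$\mathcal Z_\Delta=\int_{(0,\infty)^F}\prod_f\mathcal A_f\prod_e\mathcal A_e\prod_v\mathcal A_v\prod_fp_f^2\,dp_f .$$ The face factors are $$F_f(p,r,x)=\frac{\prod_{v\in f}\sin(p\,\phi_{f,v})\prod_{e\in f}\sin(p\,r_e)}{p^{\deg_V(f)+\deg_E(f)-2}} .$$ Then: 1. $\deg_V(f)+\deg_E(f)\ge 6$ for every $f\in F$, and $\alpha_e\ge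 2$ for every $e\in E$. 2. For all the choices above, the face-factored partition function is absolutely integrable: $\int_0^\infty|F_f|\,dp<\infty$ for all $f$, $r$ and $x$; the function $$\prod_e\frac{2}{\pi\sinh^2 r_e}\ \prod_v\prod_{f\ni v}\frac1{\sinh\phi_{f,v}}\ \prod_f\int_0^\infty |F_f(p,r,x)|\,dp$$ of $(r,x)$ (the $r_e\in(0,\infty)$, the $x_{(e,v)}\in H^3_+$ with $e\neq e_0^v$) is integrable, as is the same function with $F_f$ in place of $|F_f|$; and the integrand of $\mathcal Z_\Delta$ before any integration is integrable in all variables $(p,r,x)$ together. 3. $\mathcal Z_\Delta$ is finite and the face factoring is justified: for every $p\in(0,\infty)^F$ the integrals defining $\mathcal A_e$ and $\mathcal A_v$ converge absolutely, the integral over $p$ defining $\mathcal Z_\Delta$ converges absolutely, and $$\mathcal Z_\Delta=\int dr\int dx\ \prod_e\frac{2}{\pi\sinh^2 r_e}\ \prod_v\prod_{f\ni v}\frac1{\sinh\phi_{f,v}}\ \prod_f\int_0^\infty F_f(p,r,x)\,dp .$$ -/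

import Mathlib

open MeasureTheory Set Finset
open scoped Real

noncomputable section

namespace SpinFoam

/-! ## Triangulated closed 4-manifolds -/

/-- The stellar subdivision of `L` at a face `A` with new vertex `a`: the open star of `A` is
removed and the cone `a * ∂A * lk(A)` is inserted. -/
def IsStellarSubdivision (L L' : PreAbstractSimplicialComplex ℕ) : Prop :=
  ∃ A ∈ L.faces, ∃ a : ℕ, {a} ∉ L.faces ∧
    ∀ s : Finset ℕ, s ∈ L'.faces ↔
      (s ∈ L.faces ∧ ¬ A ⊆ s) ∨ ∃ t : Finset ℕ, ¬ A ⊆ t ∧ t ∪ A ∈ L.faces ∧ s = insert a t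

/-- The boundary complex of the `(n + 1)`-simplex with vertices `0, …, n + 1`. -/
def boundarySimplex (n : ℕ) : PreAbstractSimplicialComplex ℕ where
  faces := {s | s.Nonempty ∧ s ⊂ Finset.range (n + 2)}
  isRelLowerSet_faces := fun _ hs =>
    ⟨hs.1, fun _ hts ht => ⟨ht, lt_of_le_of_lt hts hs.2⟩⟩

/-- A combinatorial (PL) `n`-sphere: a simplicial complex that is related to the boundary of the
`(n + 1)`-simplex by a finite chain of stellar subdivisions and inverses of such.
(The injection `g` only labels the vertices by natural numbers, so that there is room for new
vertices.) -/
def IsCombinatorialSphere {V : Type*} (n : ℕ) (L : PreAbstractSimplicialComplex V) : Prop :=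
  ∃ g : V → ℕ, Function.Injective g ∧
    Relation.EqvGen IsStellarSubdivision (L.map g) (boundarySimplex n)

variable {V : Type*} [DecidableEq V]

/-- The link of a vertex. -/
def link (K : AbstractSimplicialComplex V) (v : V) : PreAbstractSimplicialComplex V where
  faces := {s | s.Nonempty ∧ v ∉ s ∧ insert v s ∈ K.faces}
  isRelLowerSet_faces := fun _ hs =>
    ⟨hs.1, fun _ hts ht => ⟨ht, fun hv => hs.2.1 (hts hv),
      (K.isRelLowerSet_faces hs.2.2).2 (Finset.insert_subset_insert v hts)
        (Finset.insert_nonempty _ _)⟩⟩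

/-- `K` triangulates a closed `4`-manifold: the link of every vertex is a combinatorial
`3`-sphere. (Finiteness of `K` is finiteness of its vertex type.) As `K` is a genuine simplicial
complex, the triangulation is non-degenerate. -/
def IsClosedFourManifold (K : AbstractSimplicialComplex V) : Prop :=
  ∀ v : V, IsCombinatorialSphere 3 (link K v)

/-! ## The dual 2-skeleton -/

/-- Dual vertices are the 4-simplices. -/
abbrev DualVertex (K : AbstractSimplicialComplex V) : Type _ :=
  {s : Finset V // s ∈ K.faces ∧ s.card = 5}

/-- Dual edges are the tetrahedra. -/
abbrev DualEdge (K : AbstractSimplicialComplex V) : Type _ :=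
  {s : Finset V // s ∈ K.faces ∧ s.card = 4}

/-- Dual faces are the triangles. -/
abbrev DualFace (K : AbstractSimplicialComplex V) : Type _ :=
  {s : Finset V // s ∈ K.faces ∧ s.card = 3}

instance [Fintype V] (K : AbstractSimplicialComplex V) : Fintype (DualVertex K) :=
  Fintype.ofFinite _

instance [Fintype V] (K : AbstractSimplicialComplex V) : Fintype (DualEdge K) :=
  Fintype.ofFinite _

instance [Fintype V] (K : AbstractSimplicialComplex V) : Fintype (DualFace K) :=
  Fintype.ofFinite _

variable [Fintype V] {K : AbstractSimplicialComplex V}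

/-- The number of dual vertices of the dual polygon `f`: the 4-simplices containing the
triangle. -/
def degV (f : DualFace K) : ℕ := #{v : DualVertex K | f.1 ⊆ v.1}

/-- The number of dual edges of the dual polygon `f`: the tetrahedra containing the triangle. -/
def degE (f : DualFace K) : ℕ := #{e : DualEdge K | f.1 ⊆ e.1}

/-- The exponent `α_e = ∑_{f ∋ e} (1 - 3 / (deg_V f + deg_E f))`. -/
def alpha (e : DualEdge K) : ℝ :=
  ∑ f : DualFace K with f.1 ⊆ e.1, (1 - 3 / ((degV f : ℝ) + (degE f : ℝ)))

/-! ## The hyperboloid -/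

/-- The Minkowski inner product on `ℝ⁴`. -/
def mink (x y : Fin 4 → ℝ) : ℝ := x 0 * y 0 - x 1 * y 1 - x 2 * y 2 - x 3 * y 3

/-- The future hyperboloid `H₊³`. -/
abbrev Hyperboloid : Type := {x : Fin 4 → ℝ // mink x x = 1 ∧ 0 < x 0}

/-- Hyperbolic distance. -/
def hdist (x y : Hyperboloid) : ℝ := Real.arcosh (mink x.1 y.1)

/-- The energy `√(1 + |u|²)` of a spatial vector `u`. -/
def energy (u : Fin 3 → ℝ) : ℝ := √(1 + u 0 ^ 2 + u 1 ^ 2 + u 2 ^ 2)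

/-- The point of the hyperboloid with spatial part `u`. -/
def ofSpatial (u : Fin 3 → ℝ) : Hyperboloid :=
  ⟨![energy u, u 0, u 1, u 2], by
    have h : 0 < 1 + u 0 ^ 2 + u 1 ^ 2 + u 2 ^ 2 := by positivity
    have h2 : energy u * energy u = 1 + u 0 ^ 2 + u 1 ^ 2 + u 2 ^ 2 := Real.mul_self_sqrt h.le
    constructor
    · simp [mink, h2]
      ring
    · simpa [energy] using h⟩

lemma measurable_ofSpatial : Measurable ofSpatial := by
  refine Measurable.subtype_mk (measurable_pi_lambda _ fun i => ?_)
  fin_cases i <;> simp [energy] <;> fun_prop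

/-- The Lorentz-invariant measure `d³u / √(1 + |u|²)` on the hyperboloid, which is its
Riemannian (hyperbolic) volume. -/
def hypMeasure : Measure Hyperboloid :=
  (volume.withDensity fun u : Fin 3 → ℝ => ENNReal.ofReal (1 / energy u)).map ofSpatial

instance : SigmaFinite hypMeasure := by
  have hs : MeasurableEmbedding ofSpatial := by
    refine MeasurableEmbedding.of_measurable_inverse (g := fun x => ![x.1 1, x.1 2, x.1 3])
      measurable_ofSpatial ?_ ?_ ?_
    · have hr : Set.range ofSpatial = Set.univ := by
        refine Set.eq_univ_of_forall fun x => ⟨![x.1 1, x.1 2, x.1 3], Subtype.ext ?_⟩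
        have h := x.2.1
        have e : energy ![x.1 1, x.1 2, x.1 3] = x.1 0 := by
          simp only [energy, mink] at *
          rw [Real.sqrt_eq_iff_mul_self_eq (by positivity) x.2.2.le]
          simp
          linarith
        funext i
        fin_cases i <;> simp [ofSpatial, e]
      rw [hr]
      exact MeasurableSet.univ
    · have hm : ∀ j : Fin 4, Measurable fun x : Hyperboloid => x.1 j := fun j =>
        (measurable_pi_apply j).comp measurable_subtype_coe
      refine measurable_pi_lambda _ fun i => ?_
      fin_cases i
      exacts [hm 1, hm 2, hm 3]
    · intro u
      funext i
      fin_cases i <;> simp [ofSpatial]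
  have : SigmaFinite (volume.withDensity fun u : Fin 3 → ℝ => ENNReal.ofReal (1 / energy u)) :=
    SigmaFinite.withDensity_ofReal _
  exact hs.sigmaFinite_map

/-- The kernel `K_p(x, y) = sin (p φ(x, y)) / (p sinh φ(x, y))`. -/
def kernel (p : ℝ) (x y : Hyperboloid) : ℝ :=
  Real.sin (p * hdist x y) / (p * Real.sinh (hdist x y))

/-! ## The Perez–Rovelli model -/

/-- The free choices in the definition of the vertex amplitudes: for every dual vertex `v` the
dual edge `e₀` at `v` whose integration is dropped and the value `base v` at which its variable
is fixed, and for every dual face `f` containing `v` a labelling `e₊(f, v)`, `e₋(f, v)` of the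
two dual edges that contain `v` and are contained in `f`. -/
structure Choices (K : AbstractSimplicialComplex V) where
  e₀ : DualVertex K → DualEdge K
  e₀_subset : ∀ v, (e₀ v).1 ⊆ v.1
  base : DualVertex K → Hyperboloid
  ePlus : DualFace K → DualVertex K → DualEdge K
  eMinus : DualFace K → DualVertex K → DualEdge K
  ePlus_spec : ∀ f v, f.1 ⊆ v.1 → f.1 ⊆ (ePlus f v).1 ∧ (ePlus f v).1 ⊆ v.1
  eMinus_spec : ∀ f v, f.1 ⊆ v.1 → f.1 ⊆ (eMinus f v).1 ∧ (eMinus f v).1 ⊆ v.1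
  ePlus_ne_eMinus : ∀ f v, f.1 ⊆ v.1 → ePlus f v ≠ eMinus f v

/-- The dual edges at `v` other than `e₀ v`. -/
abbrev Choices.FreeEdge (c : Choices K) (v : DualVertex K) : Type _ :=
  {e : DualEdge K // e.1 ⊆ v.1 ∧ e ≠ c.e₀ v}

/-- The hyperboloid variables `x_{(e, v)}` that are integrated over, for a single `v`. -/
abbrev Choices.VertexConfig (c : Choices K) (v : DualVertex K) : Type _ :=
  c.FreeEdge v → Hyperboloid

/-- All hyperboloid variables `x_{(e, v)}` that are integrated over. -/
abbrev Choices.HypConfig (c : Choices K) : Type _ :=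
  (v : DualVertex K) → c.VertexConfig v

/-- The value of the hyperboloid variable at the edge `e` of `v`, equal to `base v` for the edge
`e₀ v`. -/
def Choices.val (c : Choices K) (v : DualVertex K) (x : c.VertexConfig v) (e : DualEdge K) :
    Hyperboloid :=
  if h : e.1 ⊆ v.1 ∧ e ≠ c.e₀ v then x ⟨e, h⟩ else c.base v

/-- The hyperbolic distance `φ(x_{e₊(f, v)}, x_{e₋(f, v)})`. -/
def Choices.phi (c : Choices K) (f : DualFace K) (v : DualVertex K) (x : c.VertexConfig v) : ℝ :=
  hdist (c.val v x (c.ePlus f v)) (c.val v x (c.eMinus f v))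

/-- The measure `∏_{e ∋ v, e ≠ e₀} dx_{(e, v)}`. -/
def Choices.vertexMeasure (c : Choices K) (v : DualVertex K) : Measure (c.VertexConfig v) :=
  Measure.pi fun _ => hypMeasure

/-- The measure `∏_v ∏_{e ∋ v, e ≠ e₀} dx_{(e, v)}`. -/
def Choices.hypConfigMeasure (c : Choices K) : Measure c.HypConfig :=
  Measure.pi fun v => c.vertexMeasure v

/-- Lebesgue measure on `(0, ∞)^ι`. -/
def posMeasure (ι : Type*) [Fintype ι] : Measure (ι → ℝ) :=
  Measure.pi fun _ => volume.restrict (Set.Ioi 0)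

/-- The integrand of the regularized vertex amplitude. -/
def Choices.vertexIntegrand (c : Choices K) (p : DualFace K → ℝ) (v : DualVertex K)
    (x : c.VertexConfig v) : ℝ :=
  ∏ f : DualFace K with f.1 ⊆ v.1,
    kernel (p f) (c.val v x (c.ePlus f v)) (c.val v x (c.eMinus f v))

/-- The regularized vertex amplitude `𝒜_v`. -/
def Choices.vertexAmplitude (c : Choices K) (p : DualFace K → ℝ) (v : DualVertex K) : ℝ :=
  ∫ x, c.vertexIntegrand p v x ∂(c.vertexMeasure v)

/-- The integrand of the eye diagram of the dual edge `e`. -/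
def eyeIntegrand (p : DualFace K → ℝ) (e : DualEdge K) (r : ℝ) : ℝ :=
  (∏ f : DualFace K with f.1 ⊆ e.1, Real.sin (p f * r)) / Real.sinh r ^ 2

/-- The edge amplitude `𝒜_e = Θ₄` of the four spins on the dual faces containing `e`. -/
def edgeAmplitude (p : DualFace K → ℝ) (e : DualEdge K) : ℝ :=
  2 / (π * ∏ f : DualFace K with f.1 ⊆ e.1, p f) * ∫ r in Set.Ioi 0, eyeIntegrand p e r

/-- The face amplitude `𝒜_f = 1`. -/
def faceAmplitude (_p : ℝ) : ℝ := 1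

/-- The integrand of the partition function, as a function of the spins. -/
def Choices.spinIntegrand (c : Choices K) (p : DualFace K → ℝ) : ℝ :=
  (∏ f, faceAmplitude (p f)) * (∏ e, edgeAmplitude p e) * (∏ v, c.vertexAmplitude p v) *
    ∏ f, p f ^ 2

/-- The partition function `𝒵_Δ`. -/
def Choices.partitionFunction (c : Choices K) : ℝ :=
  ∫ p, c.spinIntegrand p ∂(posMeasure (DualFace K))

/-- The integrand of the partition function before any integration: a function of the spins
`p_f`, the edge variables `r_e` and the hyperboloid variables `x_{(e, v)}`. -/
def Choices.totalIntegrand (c : Choices K) (p : DualFace K → ℝ) (r : DualEdge K → ℝ)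
    (x : c.HypConfig) : ℝ :=
  (∏ f, faceAmplitude (p f)) *
    (∏ e, 2 / (π * ∏ f : DualFace K with f.1 ⊆ e.1, p f) * eyeIntegrand p e (r e)) *
    (∏ v, c.vertexIntegrand p v (x v)) * ∏ f, p f ^ 2

/-! ## The face factored form -/

/-- The face factor `F_f(p, φ, r)`. -/
def Choices.faceFactor (c : Choices K) (f : DualFace K) (r : DualEdge K → ℝ) (x : c.HypConfig)
    (p : ℝ) : ℝ :=
  ((∏ v : DualVertex K with f.1 ⊆ v.1, Real.sin (p * c.phi f v (x v))) *
    ∏ e : DualEdge K with f.1 ⊆ e.1, Real.sin (p * r e)) /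
      p ^ ((degV f : ℤ) + (degE f : ℤ) - 2)

/-- The factor `∏_e 2 / (π sinh² r_e) · ∏_v ∏_{f ∋ v} 1 / sinh φ` of the face factored form. -/
def Choices.sinhFactor (c : Choices K) (r : DualEdge K → ℝ) (x : c.HypConfig) : ℝ :=
  (∏ e, 2 / (π * Real.sinh (r e) ^ 2)) *
    ∏ v, ∏ f : DualFace K with f.1 ⊆ v.1, 1 / Real.sinh (c.phi f v (x v))

/-- The integrand of the face factored partition function. -/
def Choices.faceFactoredIntegrand (c : Choices K) (r : DualEdge K → ℝ) (x : c.HypConfig) : ℝ :=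
  c.sinhFactor r x * ∏ f, ∫ p in Set.Ioi 0, c.faceFactor f r x p

/-- The integrand of the absolute bound of the face factored partition function: every face
factor is replaced by its absolute value. -/
def Choices.absFaceFactoredIntegrand (c : Choices K) (r : DualEdge K → ℝ) (x : c.HypConfig) :
    ℝ :=
  |c.sinhFactor r x| * ∏ f, ∫ p in Set.Ioi 0, |c.faceFactor f r x p|

/-- The face factored form of the partition function. -/
def Choices.faceFactoredPartitionFunction (c : Choices K) : ℝ :=
  ∫ r, (∫ x, c.faceFactoredIntegrand r x ∂c.hypConfigMeasure) ∂(posMeasure (DualEdge K))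

end SpinFoam

end

/-! Everything follows from one integrable majorant of the full integrand in which all variables
separate; the rest is Fubini.

Combinatorics: being pure with at least two facets through every ridge is invariant under stellar
moves, so vertex links have this property. Crossing two tetrahedra around a triangle then produces
three 4-simplices and three tetrahedra, hence `n = degV f + degE f ≥ 6`.

Face factors: both `|sin (p a)| ≤ p g(a)` and `|sin (p a)| ≤ p^(1/3) g(a)` hold with `g(a) = a^(1/3)
+ a`. The first, used for `p ≤ 1`, bounds the powers of `p` in `F_f` by `p^2`; the second, used for
`p ≥ 1`, by `p^(2 - 2n/3) ≤ p^(-2)`, since `n ≥ 6`. Thus `|F_f|` is at most `2 / (1 + p^2)` times a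
product of gauges (`abs_faceFactor_le`), and the gauges can be redistributed to edges and vertices
(`abs_totalIntegrand_le`).

Edges: each of the four triangles gives one gauge, and `g(r)^4 / sinh² r` behaves like `r^(-2/3)` at
zero and decays exponentially (`integrableOn_eyeMajorant`).

Vertices: the ten factors `g(φ) / sinh φ` sit on the edges of the complete graph on five points of
the hyperboloid, one of them fixed. The arithmetic-geometric mean inequality bounds their product by
a sum over the five spanning stars of products of `5/2`-th powers. A star is integrated leaf by
leaf; by Lorentz invariance (`lintegral_mink`) each leaf contributes the same constant, finite
because `sinh^(-5/2) φ`, even with a small extra growth, is integrable against the hyperbolic volume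
`sinh² φ dφ` (`integrable_prod_majorant`). -/

noncomputable section

namespace SpinFoam

/-! ## Pseudomanifolds and stellar subdivisions -/

/-- The complex is pure of dimension `n`, and every `(n - 1)`-simplex lies in at least two
`n`-simplices. -/
structure IsPseudomanifold {W : Type*} (n : ℕ) (L : PreAbstractSimplicialComplex W) : Prop where
  card_le : ∀ s ∈ L.faces, s.card ≤ n + 1
  exists_facet : ∀ s ∈ L.faces, ∃ t ∈ L.faces, s ⊆ t ∧ t.card = n + 1
  exists_two_facets : ∀ s ∈ L.faces, s.card = n → ∃ t ∈ L.faces, ∃ t' ∈ L.faces,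
    t ≠ t' ∧ s ⊆ t ∧ s ⊆ t' ∧ t.card = n + 1 ∧ t'.card = n + 1

section Stellar

variable {n : ℕ} {L L' : PreAbstractSimplicialComplex ℕ} {A : Finset ℕ} {a : ℕ}

lemma notMem_of_singleton_notMem (ha : {a} ∉ L.faces) {s : Finset ℕ} (hs : s ∈ L.faces) :
    a ∉ s := fun h =>
  ha ((L.isRelLowerSet_faces hs).2 (Finset.singleton_subset_iff.2 h) (Finset.singleton_nonempty a))

lemma exists_mem_notMem {s A : Finset ℕ} (h : ¬ A ⊆ s) : ∃ x ∈ A, x ∉ s := by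
  simpa [Finset.subset_iff] using h

lemma card_eq_succ_exists {s t : Finset ℕ} (h : s ⊆ t) (hc : t.card = s.card + 1) :
    ∃ x, x ∉ s ∧ t = insert x s := by
  obtain ⟨x, hx⟩ := Finset.card_eq_one.1 (by rw [Finset.card_sdiff_of_subset h]; omega :
    (t \ s).card = 1)
  refine ⟨x, ?_, ?_⟩
  · have : x ∈ t \ s := by simp [hx]
    exact (Finset.mem_sdiff.1 this).2
  · rw [← Finset.sdiff_union_of_subset h, hx]; rfl

lemma erase_union_eq {s A : Finset ℕ} {x : ℕ} (hA : A ⊆ s) (hx : x ∈ A) : s.erase x ∪ A = s := by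
  ext y
  have := @hA y
  simp only [Finset.mem_union, Finset.mem_erase]
  constructor
  · rintro (h | h)
    exacts [h.2, this h]
  · intro h
    by_cases hy : y = x
    · exact Or.inr (hy ▸ hx)
    · exact Or.inl ⟨hy, h⟩

/-- The exchange behind both directions of invariance: a face containing `A` trades one vertex of
`A` for `a`, keeping its cardinality. -/
lemma insert_erase_mem (hL' : ∀ s : Finset ℕ, s ∈ L'.faces ↔
      (s ∈ L.faces ∧ ¬ A ⊆ s) ∨ ∃ t : Finset ℕ, ¬ A ⊆ t ∧ t ∪ A ∈ L.faces ∧ s = insert a t)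
    {s : Finset ℕ} (hs : s ∈ L.faces) (hA : A ⊆ s) {x : ℕ} (hx : x ∈ A) :
    insert a (s.erase x) ∈ L'.faces :=
  (hL' _).2 (Or.inr ⟨s.erase x, fun h => Finset.notMem_erase x s (h hx),
    by rwa [erase_union_eq hA hx], rfl⟩)

lemma card_insert_erase (ha : {a} ∉ L.faces) {s : Finset ℕ} (hs : s ∈ L.faces) {x : ℕ}
    (hx : x ∈ s) : (insert a (s.erase x)).card = s.card := by
  rw [Finset.card_insert_of_notMem
    (fun h => notMem_of_singleton_notMem ha hs (Finset.mem_of_mem_erase h)),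
    Finset.card_erase_add_one hx]

/-- A facet containing `A` is replaced by its exchanges of some `x ∈ A` for `a`. Around an old ridge
`s` at most one facet contains `A`, since such a facet must be `s` plus the unique vertex of `A`
missing from `s`; it is replaced by `insert a s`. For a new ridge `insert a t`, either `t ∪ A` is a
ridge, whose two facets are exchanged at the same `x`, or `t ∪ A` is a facet, and `t` misses two
vertices of `A` at which to exchange. -/
lemma isPseudomanifold_of_stellar (h : IsStellarSubdivision L L') (hL : IsPseudomanifold n L) :
    IsPseudomanifold n L' := by
  obtain ⟨A, hA, a, ha, hL'⟩ := h
  refine ⟨fun s hs => ?_, fun s hs => ?_, fun s hs hsn => ?_⟩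
  · rcases (hL' s).1 hs with h | ⟨t, hAt, ht, rfl⟩
    · exact hL.card_le s h.1
    · have h1 := hL.card_le _ ht
      have h2 : t.card < (t ∪ A).card := Finset.card_lt_card
        ⟨Finset.subset_union_left, fun h => hAt (Finset.subset_union_right.trans h)⟩
      have := Finset.card_insert_le a t
      omega
  · rcases (hL' s).1 hs with h | ⟨t, hAt, ht, rfl⟩
    · obtain ⟨T, hT, hsT, hTc⟩ := hL.exists_facet s h.1
      by_cases hAT : A ⊆ T
      · obtain ⟨x, hx, hxs⟩ := exists_mem_notMem h.2
        refine ⟨_, insert_erase_mem hL' hT hAT hx, ?_, ?_⟩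
        · intro y hy
          refine Finset.mem_insert_of_mem (Finset.mem_erase.2 ⟨?_, hsT hy⟩)
          rintro rfl
          exact hxs hy
        · rw [card_insert_erase ha hT (hAT hx), hTc]
      · exact ⟨T, (hL' T).2 (Or.inl ⟨hT, hAT⟩), hsT, hTc⟩
    · obtain ⟨T, hT, hsT, hTc⟩ := hL.exists_facet _ ht
      have hAT : A ⊆ T := Finset.subset_union_right.trans hsT
      obtain ⟨x, hx, hxs⟩ := exists_mem_notMem hAt
      refine ⟨_, insert_erase_mem hL' hT hAT hx, Finset.insert_subset_insert _ ?_, ?_⟩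
      · intro y hy
        refine Finset.mem_erase.2 ⟨?_, hsT (Finset.mem_union_left _ hy)⟩
        rintro rfl
        exact hxs hy
      · rw [card_insert_erase ha hT (hAT hx), hTc]
  · rcases (hL' s).1 hs with h | ⟨t, hAt, ht, rfl⟩
    · obtain ⟨T, hT, T', hT', hne, hsT, hsT', hTc, hTc'⟩ := hL.exists_two_facets s h.1 hsn
      have key : ∀ T ∈ L.faces, s ⊆ T → T.card = n + 1 → A ⊆ T → ∃ x ∈ A, T = insert x s := by
        intro T hT hsT hTc hAT
        obtain ⟨x, hx, rfl⟩ := card_eq_succ_exists hsT (by omega)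
        refine ⟨x, ?_, rfl⟩
        by_contra hxA
        exact h.2 ((Finset.subset_insert_iff_of_notMem hxA).1 hAT)
      have new : ∀ T ∈ L.faces, s ⊆ T → T.card = n + 1 → A ⊆ T →
          insert a s ∈ L'.faces ∧ (insert a s).card = n + 1 := by
        intro T hT hsT hTc hAT
        obtain ⟨x, hx, rfl⟩ := key T hT hsT hTc hAT
        have hxs : x ∉ s := fun hxs => by
          rw [Finset.insert_eq_of_mem hxs] at hTc
          omega
        have h1 := insert_erase_mem hL' hT hAT hx
        have h2 := card_insert_erase ha hT (hAT hx)
        rw [Finset.erase_insert hxs] at h1 h2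
        exact ⟨h1, h2.trans hTc⟩
      have hne' : ∀ T ∈ L.faces, insert a s ≠ T := by
        rintro T hT rfl
        exact notMem_of_singleton_notMem ha hT (Finset.mem_insert_self _ _)
      by_cases hAT : A ⊆ T <;> by_cases hAT' : A ⊆ T'
      · obtain ⟨x, hx, rfl⟩ := key T hT hsT hTc hAT
        obtain ⟨y, hy, rfl⟩ := key T' hT' hsT' hTc' hAT'
        exfalso
        apply hne
        rcases Finset.mem_insert.1 (hAT hy) with rfl | h'
        · rfl
        · rw [Finset.insert_eq_of_mem h'] at hTc'
          omega
      · obtain ⟨h1, h2⟩ := new T hT hsT hTc hAT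
        exact ⟨_, h1, T', (hL' T').2 (Or.inl ⟨hT', hAT'⟩), hne' T' hT', Finset.subset_insert _ _,
          hsT', h2, hTc'⟩
      · obtain ⟨h1, h2⟩ := new T' hT' hsT' hTc' hAT'
        exact ⟨T, (hL' T).2 (Or.inl ⟨hT, hAT⟩), _, h1, (hne' T hT).symm, hsT,
          Finset.subset_insert _ _, hTc, h2⟩
      · exact ⟨T, (hL' T).2 (Or.inl ⟨hT, hAT⟩), T', (hL' T').2 (Or.inl ⟨hT', hAT'⟩), hne, hsT,
          hsT', hTc, hTc'⟩
    · have hat : a ∉ t := fun h =>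
        notMem_of_singleton_notMem ha ht (Finset.mem_union_left _ h)
      rw [Finset.card_insert_of_notMem hat] at hsn
      have key : ∀ T ∈ L.faces, t ∪ A ⊆ T → T.card = n + 1 → ∀ x ∈ A, x ∉ t →
          insert a (T.erase x) ∈ L'.faces ∧ insert a t ⊆ insert a (T.erase x) ∧
            (insert a (T.erase x)).card = n + 1 := by
        intro T hT hsT hTc x hx hxt
        have hAT : A ⊆ T := Finset.subset_union_right.trans hsT
        refine ⟨insert_erase_mem hL' hT hAT hx, Finset.insert_subset_insert _ fun y hy =>
          Finset.mem_erase.2 ⟨?_, hsT (Finset.mem_union_left _ hy)⟩, ?_⟩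
        · rintro rfl
          exact hxt hy
        · rw [card_insert_erase ha hT (hAT hx), hTc]
      have hne : ∀ T ∈ L.faces, ∀ T' ∈ L.faces, ∀ x y,
          insert a (T.erase x) = insert a (T'.erase y) → T.erase x = T'.erase y := by
        intro T hT T' hT' x y h
        have h1 := notMem_of_singleton_notMem ha hT
        have h2 := notMem_of_singleton_notMem ha hT'
        rw [← Finset.erase_insert (fun h => h1 (Finset.mem_of_mem_erase h) : a ∉ T.erase x), h,
          Finset.erase_insert (fun h => h2 (Finset.mem_of_mem_erase h) : a ∉ T'.erase y)]
      obtain ⟨x, hx, hxt⟩ := exists_mem_notMem hAt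
      by_cases hc : (t ∪ A).card = n
      · obtain ⟨T, hT, T', hT', hTT, hsT, hsT', hTc, hTc'⟩ := hL.exists_two_facets _ ht hc
        obtain ⟨h1, h2, h3⟩ := key T hT hsT hTc x hx hxt
        obtain ⟨h1', h2', h3'⟩ := key T' hT' hsT' hTc' x hx hxt
        refine ⟨_, h1, _, h1', fun h => hTT ?_, h2, h2', h3, h3'⟩
        have := hne T hT T' hT' x x h
        rw [← Finset.insert_erase (hsT (Finset.mem_union_right _ hx)), this,
          Finset.insert_erase (hsT' (Finset.mem_union_right _ hx))]
      · have h1 := hL.card_le _ ht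
        have h2 : t.card < (t ∪ A).card := Finset.card_lt_card
          ⟨Finset.subset_union_left, fun h => hAt (Finset.subset_union_right.trans h)⟩
        have hc' : (t ∪ A).card = n + 1 := by omega
        obtain ⟨y, hy, hyt⟩ : ∃ y ∈ A, y ∉ insert x t := by
          apply exists_mem_notMem
          intro h
          have h3 : t ∪ A ⊆ insert x t := Finset.union_subset (Finset.subset_insert _ _) h
          have h4 := Finset.card_le_card h3
          have := Finset.card_insert_le x t
          omega
        have hyx : y ≠ x := fun h => hyt (by simp [h])
        have hyt' : y ∉ t := fun h => hyt (by simp [h])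
        obtain ⟨h1, h2, h3⟩ := key _ ht subset_rfl hc' x hx hxt
        obtain ⟨h1', h2', h3'⟩ := key _ ht subset_rfl hc' y hy hyt'
        refine ⟨_, h1, _, h1', fun h => ?_, h2, h2', h3, h3'⟩
        have h4 := hne _ ht _ ht x y h
        have h5 : y ∈ (t ∪ A).erase x := Finset.mem_erase.2 ⟨hyx, Finset.mem_union_right _ hy⟩
        rw [h4] at h5
        exact Finset.notMem_erase _ _ h5

/-- The exchange is undone. A ridge `s` containing `A` is pushed to the ridge `insert a (s.erase
x)`, whose facets `insert a t` come back as `t ∪ A = insert x t`. For a ridge `s` not containing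
`A`, a facet through `a` can only be `insert a s`, so at most one of the two is new; it comes back
as `s ∪ A`, which differs from the other facet because that one does not contain `A`. -/
lemma isPseudomanifold_of_stellar_symm (h : IsStellarSubdivision L L')
    (hL : IsPseudomanifold n L') : IsPseudomanifold n L := by
  obtain ⟨A, hA, a, ha, hL'⟩ := h
  have hAne : A.Nonempty := (L.isRelLowerSet_faces hA).1
  have card_le : ∀ s ∈ L.faces, s.card ≤ n + 1 := by
    intro s hs
    by_cases hAs : A ⊆ s
    · obtain ⟨x, hx⟩ := hAne
      rw [← card_insert_erase ha hs (hAs hx)]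
      exact hL.card_le _ (insert_erase_mem hL' hs hAs hx)
    · exact hL.card_le s ((hL' s).2 (Or.inl ⟨hs, hAs⟩))
  -- Squeezed between `t.card = n` and the bound `n + 1`, the strictly larger set `t ∪ A` must be a
  -- facet.
  have facet : ∀ t : Finset ℕ, ¬ A ⊆ t → t ∪ A ∈ L.faces → (insert a t).card = n + 1 →
      t.card = n ∧ (t ∪ A).card = n + 1 := by
    intro t hAt ht htc
    have hat : a ∉ t := fun h =>
      notMem_of_singleton_notMem ha ht (Finset.mem_union_left _ h)
    rw [Finset.card_insert_of_notMem hat] at htc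
    have h1 := card_le _ ht
    have h2 : t.card < (t ∪ A).card := Finset.card_lt_card
      ⟨Finset.subset_union_left, fun h => hAt (Finset.subset_union_right.trans h)⟩
    omega
  have drop : ∀ s t : Finset ℕ, a ∉ s → s ⊆ insert a t → s ⊆ t := fun s t h h' =>
    (Finset.subset_insert_iff_of_notMem h).1 h'
  refine ⟨card_le, fun s hs => ?_, fun s hs hsn => ?_⟩
  · have has := notMem_of_singleton_notMem ha hs
    by_cases hAs : A ⊆ s
    · obtain ⟨x, hx⟩ := hAne
      obtain ⟨T, hT, hsT, hTc⟩ := hL.exists_facet _ (insert_erase_mem hL' hs hAs hx)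
      have haT : a ∈ T := hsT (Finset.mem_insert_self _ _)
      rcases (hL' T).1 hT with h | ⟨t, hAt, ht, rfl⟩
      · exact absurd haT (notMem_of_singleton_notMem ha h.1)
      · refine ⟨_, ht, ?_, (facet t hAt ht hTc).2⟩
        have h1 : s.erase x ⊆ t := drop _ _ (fun h => has (Finset.mem_of_mem_erase h))
          ((Finset.subset_insert _ _).trans hsT)
        rw [← erase_union_eq hAs hx]
        exact Finset.union_subset_union_left h1
    · obtain ⟨T, hT, hsT, hTc⟩ := hL.exists_facet s ((hL' s).2 (Or.inl ⟨hs, hAs⟩))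
      rcases (hL' T).1 hT with h | ⟨t, hAt, ht, rfl⟩
      · exact ⟨T, h.1, hsT, hTc⟩
      · exact ⟨_, ht, (drop _ _ has hsT).trans Finset.subset_union_left, (facet t hAt ht hTc).2⟩
  · have has := notMem_of_singleton_notMem ha hs
    by_cases hAs : A ⊆ s
    · obtain ⟨x, hx⟩ := hAne
      have hc := card_insert_erase ha hs (hAs hx)
      obtain ⟨T, hT, T', hT', hne, hsT, hsT', hTc, hTc'⟩ :=
        hL.exists_two_facets _ (insert_erase_mem hL' hs hAs hx) (by omega)
      have key : ∀ T ∈ L'.faces, insert a (s.erase x) ⊆ T → T.card = n + 1 →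
          ∃ t : Finset ℕ, T = insert a t ∧ x ∉ t ∧ t ∪ A ∈ L.faces ∧ s ⊆ t ∪ A ∧
            (t ∪ A).card = n + 1 ∧ t ∪ A = insert x t := by
        intro T hT hsT hTc
        have haT : a ∈ T := hsT (Finset.mem_insert_self _ _)
        rcases (hL' T).1 hT with h | ⟨t, hAt, ht, rfl⟩
        · exact absurd haT (notMem_of_singleton_notMem ha h.1)
        · have h1 : s.erase x ⊆ t := drop _ _ (fun h => has (Finset.mem_of_mem_erase h))
            ((Finset.subset_insert _ _).trans hsT)
          have h2 : s ⊆ insert x t := by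
            rw [← Finset.insert_erase (hAs hx)]
            exact Finset.insert_subset_insert _ h1
          have hxt : x ∉ t := fun hxt => hAt
            (hAs.trans (by rwa [Finset.insert_eq_of_mem hxt] at h2))
          refine ⟨t, rfl, hxt, ht, ?_, (facet t hAt ht hTc).2, ?_⟩
          · rw [← erase_union_eq hAs hx]
            exact Finset.union_subset_union_left h1
          · refine Finset.Subset.antisymm
              (Finset.union_subset (Finset.subset_insert _ _) (hAs.trans h2)) ?_
            exact Finset.insert_subset (Finset.mem_union_right _ hx) Finset.subset_union_left
      obtain ⟨t, rfl, hxt, h1, h2, h3, h4⟩ := key T hT hsT hTc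
      obtain ⟨t', rfl, hxt', h1', h2', h3', h4'⟩ := key T' hT' hsT' hTc'
      refine ⟨_, h1, _, h1', fun h => hne ?_, h2, h2', h3, h3'⟩
      rw [h4, h4'] at h
      rw [← Finset.erase_insert hxt, h, Finset.erase_insert hxt']
    · obtain ⟨T, hT, T', hT', hne, hsT, hsT', hTc, hTc'⟩ :=
        hL.exists_two_facets s ((hL' s).2 (Or.inl ⟨hs, hAs⟩)) hsn
      have key : ∀ t : Finset ℕ, ¬ A ⊆ t → t ∪ A ∈ L.faces → s ⊆ insert a t →
          (insert a t).card = n + 1 → t = s := fun t hAt ht hst htc =>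
        (Finset.eq_of_subset_of_card_le (drop _ _ has hst)
          (by rw [(facet t hAt ht htc).1, hsn])).symm
      rcases (hL' T).1 hT with h | ⟨t, hAt, ht, rfl⟩ <;>
        rcases (hL' T').1 hT' with h' | ⟨t', hAt', ht', rfl⟩
      · exact ⟨T, h.1, T', h'.1, hne, hsT, hsT', hTc, hTc'⟩
      · obtain rfl := key t' hAt' ht' hsT' hTc'
        exact ⟨T, h.1, _, ht', fun hh => h.2 (hh ▸ Finset.subset_union_right), hsT,
          Finset.subset_union_left, hTc, (facet _ hAt' ht' hTc').2⟩
      · obtain rfl := key t hAt ht hsT hTc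
        exact ⟨_, ht, T', h'.1, fun hh => h'.2 (hh ▸ Finset.subset_union_right),
          Finset.subset_union_left, hsT', (facet _ hAt ht hTc).2, hTc'⟩
      · exact absurd (by rw [key t hAt ht hsT hTc, key t' hAt' ht' hsT' hTc']) hne

lemma isPseudomanifold_iff_of_eqvGen (h : Relation.EqvGen IsStellarSubdivision L L') :
    IsPseudomanifold n L ↔ IsPseudomanifold n L' := by
  induction h with
  | rel _ _ h => exact ⟨isPseudomanifold_of_stellar h, isPseudomanifold_of_stellar_symm h⟩
  | refl _ => rfl
  | symm _ _ _ ih => exact ih.symm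
  | trans _ _ _ _ _ ih ih' => exact ih.trans ih'

end Stellar

lemma isPseudomanifold_boundarySimplex (n : ℕ) : IsPseudomanifold n (boundarySimplex n) := by
  have facet : ∀ x ∈ Finset.range (n + 2), (Finset.range (n + 2)).erase x ∈
      (boundarySimplex n).faces ∧ ((Finset.range (n + 2)).erase x).card = n + 1 := by
    intro x hx
    have hc : ((Finset.range (n + 2)).erase x).card = n + 1 := by
      rw [Finset.card_erase_of_mem hx, Finset.card_range]; omega
    exact ⟨⟨Finset.card_pos.1 (by omega), Finset.erase_ssubset hx⟩, hc⟩
  have sub : ∀ s ⊆ Finset.range (n + 2), ∀ x ∉ s, s ⊆ (Finset.range (n + 2)).erase x :=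
    fun s hs x hx => Finset.subset_erase.2 ⟨hs, hx⟩
  refine ⟨fun s hs => ?_, fun s hs => ?_, fun s hs hsn => ?_⟩
  · have := Finset.card_lt_card hs.2
    rw [Finset.card_range] at this
    omega
  · obtain ⟨x, hx, hxs⟩ := Finset.exists_of_ssubset hs.2
    exact ⟨_, (facet x hx).1, sub s hs.2.1 x hxs, (facet x hx).2⟩
  · have hc : (Finset.range (n + 2) \ s).card = 2 := by
      rw [Finset.card_sdiff_of_subset hs.2.1, Finset.card_range]; omega
    obtain ⟨x, y, hxy, h⟩ := Finset.card_eq_two.1 hc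
    have hx : x ∈ Finset.range (n + 2) \ s := by simp [h]
    have hy : y ∈ Finset.range (n + 2) \ s := by simp [h]
    rw [Finset.mem_sdiff] at hx hy
    refine ⟨_, (facet x hx.1).1, _, (facet y hy.1).1, fun h => ?_, sub s hs.2.1 x hx.2,
      sub s hs.2.1 y hy.2, (facet x hx.1).2, (facet y hy.1).2⟩
    have : x ∈ (Finset.range (n + 2)).erase y := Finset.mem_erase.2 ⟨hxy, hx.1⟩
    rw [← h] at this
    exact Finset.notMem_erase _ _ this

lemma isPseudomanifold_of_isCombinatorialSphere {W : Type*} {n : ℕ}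
    {L : PreAbstractSimplicialComplex W} (h : IsCombinatorialSphere n L) :
    IsPseudomanifold n L := by
  obtain ⟨g, hg, h⟩ := h
  have hM := (isPseudomanifold_iff_of_eqvGen h).2 (isPseudomanifold_boundarySimplex n)
  have mem : ∀ s ∈ L.faces, s.image g ∈ (L.map g).faces := fun s hs => ⟨s, hs, rfl⟩
  have hc : ∀ s : Finset W, (s.image g).card = s.card := fun s =>
    Finset.card_image_of_injective s hg
  have hsub : ∀ s t : Finset W, s.image g ⊆ t.image g → s ⊆ t := fun s t h =>
    (Finset.image_subset_image_iff hg).1 h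
  refine ⟨fun s hs => ?_, fun s hs => ?_, fun s hs hsn => ?_⟩
  · rw [← hc]
    exact hM.card_le _ (mem s hs)
  · obtain ⟨_, ⟨t, ht, rfl⟩, hst, htc⟩ := hM.exists_facet _ (mem s hs)
    exact ⟨t, ht, hsub s t hst, by rw [← htc, hc]⟩
  · obtain ⟨_, ⟨t, ht, rfl⟩, _, ⟨t', ht', rfl⟩, hne, h1, h2, h3, h4⟩ :=
      hM.exists_two_facets _ (mem s hs) (by rw [hc, hsn])
    exact ⟨t, ht, t', ht', fun h => hne (by rw [h]), hsub _ _ h1, hsub _ _ h2, by rw [← h3, hc],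
      by rw [← h4, hc]⟩

/-! ## Degrees -/

section Degrees

variable {V : Type*} [DecidableEq V] {K : AbstractSimplicialComplex V}

lemma erase_mem_link {s : Finset V} (hs : s ∈ K.faces) (hc : 2 ≤ s.card) {v : V} (hv : v ∈ s) :
    s.erase v ∈ (link K v).faces := by
  refine ⟨Finset.card_pos.1 ?_, Finset.notMem_erase v s, by rwa [Finset.insert_erase hv]⟩
  rw [Finset.card_erase_of_mem hv]
  omega

/-- Faces of `K` through a vertex are faces of its link with that vertex added, so the properties of
the link at any vertex of the simplex transfer. -/
lemma exists_dualVertex (hK : IsClosedFourManifold K) (f : DualFace K) :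
    ∃ v : DualVertex K, f.1 ⊆ v.1 := by
  obtain ⟨s, hs, hc⟩ := f
  obtain ⟨v, hv⟩ : s.Nonempty := Finset.card_pos.1 (by omega)
  obtain ⟨t, ht, hst, htc⟩ := (isPseudomanifold_of_isCombinatorialSphere (hK v)).exists_facet _
    (erase_mem_link hs (by omega) hv)
  refine ⟨⟨insert v t, ht.2.2, by rw [Finset.card_insert_of_notMem ht.2.1, htc]⟩, ?_⟩
  exact (Finset.subset_insert_iff).2 hst

lemma exists_two_dualVertex (hK : IsClosedFourManifold K) (e : DualEdge K) :
    ∃ v v' : DualVertex K, v ≠ v' ∧ e.1 ⊆ v.1 ∧ e.1 ⊆ v'.1 := by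
  obtain ⟨s, hs, hc⟩ := e
  obtain ⟨v, hv⟩ : s.Nonempty := Finset.card_pos.1 (by omega)
  obtain ⟨t, ht, t', ht', hne, hst, hst', htc, htc'⟩ :=
    (isPseudomanifold_of_isCombinatorialSphere (hK v)).exists_two_facets _
    (erase_mem_link hs (by omega) hv) (by rw [Finset.card_erase_of_mem hv, hc])
  refine ⟨⟨insert v t, ht.2.2, by rw [Finset.card_insert_of_notMem ht.2.1, htc]⟩,
    ⟨insert v t', ht'.2.2, by rw [Finset.card_insert_of_notMem ht'.2.1, htc']⟩, fun h => hne ?_,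
    (Finset.subset_insert_iff).2 hst, (Finset.subset_insert_iff).2 hst'⟩
  have h := congrArg Subtype.val h
  simp only at h
  rw [← Finset.erase_insert ht.2.1, h, Finset.erase_insert ht'.2.1]

/-- Given a 4-simplex `f + a + b`, there is another one through the tetrahedron `f + a`. -/
lemma exists_opposite (hK : IsClosedFourManifold K) {f : Finset V} {a b : V}
    (h : insert a (insert b f) ∈ K.faces) (hc : f.card = 3) (ha : a ∉ f) (hb : b ∉ f)
    (hab : a ≠ b) : ∃ c, c ∉ f ∧ c ≠ a ∧ c ≠ b ∧ insert a (insert c f) ∈ K.faces := by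
  have he : insert a f ∈ K.faces := (K.isRelLowerSet_faces h).2
    (Finset.insert_subset_insert _ (Finset.subset_insert _ _)) (Finset.insert_nonempty _ _)
  have hec : (insert a f).card = 4 := by rw [Finset.card_insert_of_notMem ha, hc]
  obtain ⟨v, v', hne, h1, h2⟩ := exists_two_dualVertex hK ⟨insert a f, he, hec⟩
  have key : ∀ v : DualVertex K, insert a f ⊆ v.1 → v.1 ≠ insert a (insert b f) →
      ∃ c, c ∉ f ∧ c ≠ a ∧ c ≠ b ∧ insert a (insert c f) ∈ K.faces := by
    rintro ⟨v, hv, hvc⟩ hs hn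
    obtain ⟨c, hcv, hca⟩ := Finset.exists_mem_notMem_of_card_lt_card
      (by rw [hec, hvc]; norm_num : (insert a f).card < v.card)
    have hv' : v = insert c (insert a f) := (Finset.eq_of_subset_of_card_le
      (Finset.insert_subset hcv hs) (by rw [Finset.card_insert_of_notMem hca, hec, hvc])).symm
    rw [Finset.insert_comm] at hv'
    refine ⟨c, fun h => hca (by simp [h]), fun h => hca (by simp [h]), ?_, hv' ▸ hv⟩
    rintro rfl
    exact hn hv'
  by_cases hv : v.1 = insert a (insert b f)
  · exact key v' h2 fun h => hne (Subtype.ext (hv.trans h.symm))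
  · exact key v h1 hv

/-- From a 4-simplex `f + a + b`, crossing the tetrahedron `f + a` gives `c` and crossing `f + b`
gives `d`. The case `c = d` is allowed: the pairs `ab`, `ac`, `bd` are distinct anyway, and `a`,
`b`, `c` already give three tetrahedra. -/
lemma exists_three_cofaces (hK : IsClosedFourManifold K) (f : DualFace K) :
    ∃ a b c d, a ∉ f.1 ∧ b ∉ f.1 ∧ c ∉ f.1 ∧ d ∉ f.1 ∧ a ≠ b ∧ c ≠ a ∧ c ≠ b ∧ d ≠ a ∧ d ≠ b ∧
      insert a (insert b f.1) ∈ K.faces ∧ insert a (insert c f.1) ∈ K.faces ∧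
      insert b (insert d f.1) ∈ K.faces := by
  obtain ⟨⟨v, hv, hvc⟩, hfv⟩ := exists_dualVertex hK f
  obtain ⟨f, hf, hfc⟩ := f
  simp only at hfv ⊢
  obtain ⟨a, b, hab, h⟩ := Finset.card_eq_two.1
    (by rw [Finset.card_sdiff_of_subset hfv, hvc, hfc] : (v \ f).card = 2)
  have ha : a ∈ v \ f := by simp [h]
  have hb : b ∈ v \ f := by simp [h]
  rw [Finset.mem_sdiff] at ha hb
  have h1 : insert a (insert b f) ∈ K.faces := by
    have : insert a (insert b f) = v := by
      rw [← Finset.sdiff_union_of_subset hfv, h, Finset.insert_union]; rfl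
    rwa [this]
  obtain ⟨c, hc, hca, hcb, h2⟩ := exists_opposite hK h1 hfc ha.2 hb.2 hab
  obtain ⟨d, hd, hdb, hda, h3⟩ := exists_opposite hK (by rwa [Finset.insert_comm] at h1) hfc hb.2
    ha.2 hab.symm
  exact ⟨a, b, c, d, ha.2, hb.2, hc, hd, hab, hca, hcb, hda, hdb, h1, h2, h3⟩

variable [Fintype V]

lemma three_le_degV (hK : IsClosedFourManifold K) (f : DualFace K) : 3 ≤ degV f := by
  obtain ⟨a, b, c, d, ha, hb, hc, hd, hab, hca, hcb, hda, hdb, h1, h2, h3⟩ :=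
    exists_three_cofaces hK f
  have hcard : ∀ x y, x ∉ f.1 → y ∉ f.1 → x ≠ y → (insert x (insert y f.1)).card = 5 := by
    intro x y hx hy hxy
    rw [Finset.card_insert_of_notMem (by simp [hx, hxy]), Finset.card_insert_of_notMem hy, f.2.2]
  unfold degV
  refine Nat.succ_le_of_lt (Finset.two_lt_card.2 ?_)
  refine ⟨⟨_, h1, hcard a b ha hb hab⟩, ?_, ⟨_, h2, hcard a c ha hc hca.symm⟩, ?_,
    ⟨_, h3, hcard b d hb hd hdb.symm⟩, ?_, ?_, ?_, ?_⟩
  any_goals simp only [Finset.mem_filter, Finset.mem_univ, true_and]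
  any_goals exact (Finset.subset_insert _ _).trans (Finset.subset_insert _ _)
  · intro h
    have := Finset.ext_iff.1 (congrArg Subtype.val h) b
    simp [hb, hab.symm, hcb.symm] at this
  · intro h
    have := Finset.ext_iff.1 (congrArg Subtype.val h) a
    simp [ha, hab, hda.symm] at this
  · intro h
    have := Finset.ext_iff.1 (congrArg Subtype.val h) a
    simp [ha, hab, hda.symm] at this

lemma three_le_degE (hK : IsClosedFourManifold K) (f : DualFace K) : 3 ≤ degE f := by
  obtain ⟨a, b, c, d, ha, hb, hc, hd, hab, hca, hcb, hda, hdb, h1, h2, h3⟩ :=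
    exists_three_cofaces hK f
  have hcard : ∀ x, x ∉ f.1 → (insert x f.1).card = 4 := by
    intro x hx
    rw [Finset.card_insert_of_notMem hx, f.2.2]
  have hmem : ∀ x y, insert x (insert y f.1) ∈ K.faces → insert x f.1 ∈ K.faces ∧
      insert y f.1 ∈ K.faces := fun x y h =>
    ⟨(K.isRelLowerSet_faces h).2 (Finset.insert_subset_insert _ (Finset.subset_insert _ _))
      (Finset.insert_nonempty _ _),
    (K.isRelLowerSet_faces h).2 (Finset.subset_insert _ _) (Finset.insert_nonempty _ _)⟩
  have hne : ∀ x y, x ∉ f.1 → x ≠ y → insert x f.1 ≠ insert y f.1 := by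
    intro x y hx hxy h
    have := Finset.ext_iff.1 h x
    simp [hx, hxy] at this
  unfold degE
  refine Nat.succ_le_of_lt (Finset.two_lt_card.2 ?_)
  refine ⟨⟨_, (hmem _ _ h1).1, hcard a ha⟩, ?_, ⟨_, (hmem _ _ h1).2, hcard b hb⟩, ?_,
    ⟨_, (hmem _ _ h2).2, hcard c hc⟩, ?_, ?_, ?_, ?_⟩
  any_goals simp only [Finset.mem_filter, Finset.mem_univ, true_and]
  any_goals exact Finset.subset_insert _ _
  exacts [fun h => hne a b ha hab (congrArg Subtype.val h),
    fun h => hne a c ha hca.symm (congrArg Subtype.val h),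
    fun h => hne b c hb hcb.symm (congrArg Subtype.val h)]

lemma six_le_degV_add_degE (hK : IsClosedFourManifold K) (f : DualFace K) :
    6 ≤ degV f + degE f := by
  have := three_le_degV hK f
  have := three_le_degE hK f
  omega

lemma card_faces_of_dualEdge (e : DualEdge K) : #{f : DualFace K | f.1 ⊆ e.1} = 4 := by
  have h : (Finset.powersetCard 3 e.1).card = 4 := by
    rw [Finset.card_powersetCard, e.2.2]; rfl
  refine (Finset.card_bij (fun f _ => f.1) ?_ ?_ ?_).trans h
  · intro f hf
    exact Finset.mem_powersetCard.2 ⟨(Finset.mem_filter.1 hf).2, f.2.2⟩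
  · intro f _ f' _ h
    exact Subtype.ext h
  · intro s hs
    obtain ⟨h1, h2⟩ := Finset.mem_powersetCard.1 hs
    exact ⟨⟨s, (K.isRelLowerSet_faces e.2.1).2 h1 (Finset.card_pos.1 (by omega)), h2⟩,
      by simp [h1], rfl⟩

/-- Each of the four triangles contributes at least `1 - 3/6`. -/
lemma two_le_alpha (hK : IsClosedFourManifold K) (e : DualEdge K) : 2 ≤ alpha e := by
  unfold alpha
  have h : ∑ f : DualFace K with f.1 ⊆ e.1, (1 / 2 : ℝ) = 2 := by
    rw [Finset.sum_const, card_faces_of_dualEdge]; norm_num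
  rw [← h]
  refine Finset.sum_le_sum fun f _ => ?_
  have h6 : (6 : ℝ) ≤ (degV f : ℝ) + (degE f : ℝ) := by exact_mod_cast six_le_degV_add_degE hK f
  have : 3 / ((degV f : ℝ) + (degE f : ℝ)) ≤ 1 / 2 := by
    rw [div_le_div_iff₀ (by linarith) (by norm_num)]
    linarith
  linarith

end Degrees

/-! ## Lorentz boosts -/

lemma energy_sq (u : Fin 3 → ℝ) : energy u ^ 2 = 1 + ∑ i, u i ^ 2 := by
  rw [energy, Real.sq_sqrt (by positivity), Fin.sum_univ_three]
  ring

lemma one_le_energy (u : Fin 3 → ℝ) : 1 ≤ energy u := by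
  rw [energy, Real.one_le_sqrt]
  nlinarith [sq_nonneg (u 0), sq_nonneg (u 1), sq_nonneg (u 2)]

lemma energy_pos (u : Fin 3 → ℝ) : 0 < energy u := zero_lt_one.trans_le (one_le_energy u)

lemma sq_lt_energy_sq (u : Fin 3 → ℝ) (i : Fin 3) : u i ^ 2 < energy u ^ 2 := by
  have := Finset.single_le_sum (f := fun i => u i ^ 2) (fun i _ => sq_nonneg (u i))
    (Finset.mem_univ i)
  rw [energy_sq]
  linarith

lemma mink_ofSpatial (w u : Fin 3 → ℝ) :
    mink (ofSpatial w).1 (ofSpatial u).1 = energy w * energy u - ∑ i, w i * u i := by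
  simp only [mink, ofSpatial, Fin.sum_univ_three]
  simp
  ring

lemma sum_update_mul_update (w u : Fin 3 → ℝ) (i : Fin 3) (a b : ℝ) :
    ∑ j, Function.update w i a j * Function.update u i b j =
      ∑ j, w j * u j - w i * u i + a * b := by
  fin_cases i <;> simp [Fin.sum_univ_three] <;> ring

lemma energy_update (u : Fin 3 → ℝ) (i : Fin 3) (t : ℝ) :
    energy (Function.update u i t) = √(energy u ^ 2 - u i ^ 2 + t ^ 2) := by
  rw [← Real.sqrt_sq (energy_pos (Function.update u i t)).le, energy_sq, energy_sq]
  congr 1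
  have := sum_update_mul_update u u i t t
  simp only [← sq] at this
  rw [this]
  ring

/-- The Lorentz boost of rapidity `η` along the `i`-th axis, in terms of the spatial parts. -/
def boost (i : Fin 3) (η : ℝ) (u : Fin 3 → ℝ) : Fin 3 → ℝ :=
  Function.update u i (Real.cosh η * u i + Real.sinh η * energy u)

lemma cosh_mul_add_sinh_mul_pos (η : ℝ) {a t : ℝ} (ha : 0 < a) (h : t ^ 2 < a ^ 2) :
    0 < Real.cosh η * a + Real.sinh η * t := by
  have h1 := abs_lt_of_sq_lt_sq' h ha.le
  rw [Real.cosh_eq, Real.sinh_eq]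
  have := mul_pos (Real.exp_pos η) (by linarith : 0 < a + t)
  have := mul_pos (Real.exp_pos (-η)) (by linarith : 0 < a - t)
  linarith

lemma energy_boost (i : Fin 3) (η : ℝ) (u : Fin 3 → ℝ) :
    energy (boost i η u) = Real.cosh η * energy u + Real.sinh η * u i := by
  rw [boost, energy_update, Real.sqrt_eq_iff_mul_self_eq_of_pos
    (cosh_mul_add_sinh_mul_pos η (energy_pos u) (sq_lt_energy_sq u i))]
  linear_combination (energy u ^ 2 - u i ^ 2) * Real.cosh_sq_sub_sinh_sq η

lemma mink_boost (i : Fin 3) (η : ℝ) (w u : Fin 3 → ℝ) :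
    mink (ofSpatial (boost i η w)).1 (ofSpatial (boost i η u)).1 =
      mink (ofSpatial w).1 (ofSpatial u).1 := by
  rw [mink_ofSpatial, mink_ofSpatial, energy_boost, energy_boost, boost, boost,
    sum_update_mul_update]
  linear_combination (energy w * energy u - w i * u i) * Real.cosh_sq_sub_sinh_sq η

lemma exists_boost_eq_update_zero (i : Fin 3) (w : Fin 3 → ℝ) :
    ∃ η, boost i η w = Function.update w i 0 := by
  have hD : 0 < energy w ^ 2 - w i ^ 2 := by linarith [sq_lt_energy_sq w i]
  have hs := Real.sqrt_pos.2 hD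
  -- The rapidity with `tanh η = -w i / energy w`, which brings the `i`-th component to rest.
  refine ⟨Real.arsinh (-(w i / √(energy w ^ 2 - w i ^ 2))), ?_⟩
  have hc : √(1 + (-(w i / √(energy w ^ 2 - w i ^ 2))) ^ 2) =
      energy w / √(energy w ^ 2 - w i ^ 2) := by
    rw [Real.sqrt_eq_iff_mul_self_eq_of_pos (div_pos (energy_pos w) hs), neg_sq, div_pow,
      div_mul_div_comm, Real.mul_self_sqrt hD.le, Real.sq_sqrt hD.le]
    field_simp
    ring
  rw [boost, Real.cosh_arsinh, Real.sinh_arsinh, hc]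
  congr 1
  ring

/-- In the rapidity coordinate a boost is a translation, so it preserves `dt / √(M + t²)`. -/
lemma lintegral_boost_line {M : ℝ} (hM : 0 < M) (η : ℝ) (f : ℝ → ENNReal) :
    ∫⁻ t : ℝ, ENNReal.ofReal (1 / √(M + t ^ 2)) *
        f (Real.cosh η * t + Real.sinh η * √(M + t ^ 2)) =
      ∫⁻ t : ℝ, ENNReal.ofReal (1 / √(M + t ^ 2)) * f t := by
  have hMt : ∀ t : ℝ, 0 < M + t ^ 2 := fun t => by positivity
  have hsq : ∀ t : ℝ, 0 < √(M + t ^ 2) := fun t => Real.sqrt_pos.2 (hMt t)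
  set ψ : ℝ → ℝ → ℝ := fun η t => Real.cosh η * t + Real.sinh η * √(M + t ^ 2) with hψ
  have hψs : ∀ η t, √(M + ψ η t ^ 2) = Real.cosh η * √(M + t ^ 2) + Real.sinh η * t := by
    intro η t
    rw [Real.sqrt_eq_iff_mul_self_eq_of_pos (cosh_mul_add_sinh_mul_pos η (hsq t)
      (by rw [Real.sq_sqrt (hMt t).le]; linarith))]
    simp only [hψ]
    have h1 := Real.sq_sqrt (hMt t).le
    have h2 := Real.cosh_sq_sub_sinh_sq η
    linear_combination (Real.cosh η ^ 2 - Real.sinh η ^ 2) * h1 + M * h2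
  have hinv : ∀ η t, ψ (-η) (ψ η t) = t := by
    intro η t
    have : ψ (-η) (ψ η t) = Real.cosh (-η) * ψ η t + Real.sinh (-η) * √(M + ψ η t ^ 2) := rfl
    rw [this, hψs, Real.cosh_neg, Real.sinh_neg]
    simp only [hψ]
    linear_combination t * Real.cosh_sq_sub_sinh_sq η
  -- The derivative is the ratio of the two square roots, so `dψ / √(M + ψ²) = dt / √(M + t²)`: this
  -- is the invariance.
  have hderiv : ∀ t, HasDerivAt (ψ η) (√(M + ψ η t ^ 2) / √(M + t ^ 2)) t := by
    intro t
    have h1 : HasDerivAt (fun t : ℝ => M + t ^ 2) (2 * t) t := by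
      simpa using (hasDerivAt_pow 2 t).const_add M
    have h2 := ((hasDerivAt_id t).const_mul (Real.cosh η)).add
      ((h1.sqrt (hMt t).ne').const_mul (Real.sinh η))
    refine h2.congr_deriv ?_
    rw [hψs]
    have := (hsq t).ne'
    field_simp
  have hinj : InjOn (ψ η) univ := fun a _ b _ h => by rw [← hinv η a, h, hinv]
  have himg : ψ η '' univ = univ := by
    refine Set.eq_univ_of_forall fun t => ⟨ψ (-η) t, trivial, ?_⟩
    simpa using hinv (-η) t
  have key := lintegral_image_eq_lintegral_abs_deriv_mul MeasurableSet.univ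
    (fun t _ => (hderiv t).hasDerivWithinAt) hinj
    (fun t => ENNReal.ofReal (1 / √(M + t ^ 2)) * f t)
  rw [himg, Measure.restrict_univ] at key
  rw [key]
  refine lintegral_congr fun t => ?_
  have h1 := hsq t
  have h2 := hsq (ψ η t)
  rw [← mul_assoc, ← ENNReal.ofReal_mul (abs_nonneg _), abs_of_pos (div_pos h2 h1)]
  congr 2
  field_simp

/-! ## The invariant measure -/

lemma measurable_energy : Measurable energy := by
  unfold energy
  fun_prop

lemma measurable_mink : Measurable fun z : Hyperboloid × Hyperboloid => mink z.1.1 z.2.1 := by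
  have h1 : ∀ j : Fin 4, Measurable fun z : Hyperboloid × Hyperboloid => z.1.1 j := fun j =>
    (measurable_pi_apply j).comp (measurable_subtype_coe.comp measurable_fst)
  have h2 : ∀ j : Fin 4, Measurable fun z : Hyperboloid × Hyperboloid => z.2.1 j := fun j =>
    (measurable_pi_apply j).comp (measurable_subtype_coe.comp measurable_snd)
  unfold mink
  exact ((((h1 0).mul (h2 0)).sub ((h1 1).mul (h2 1))).sub ((h1 2).mul (h2 2))).sub
    ((h1 3).mul (h2 3))

lemma measurable_mink_ofSpatial (x : Hyperboloid) :
    Measurable fun u => mink x.1 (ofSpatial u).1 :=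
  measurable_mink.comp (measurable_const.prodMk measurable_ofSpatial)

lemma lintegral_hypMeasure {h : Hyperboloid → ENNReal} (hh : Measurable h) :
    ∫⁻ y, h y ∂hypMeasure = ∫⁻ u, ENNReal.ofReal (1 / energy u) * h (ofSpatial u) := by
  have hm : Measurable fun u => ENNReal.ofReal (1 / energy u) :=
    (measurable_const.div measurable_energy).ennreal_ofReal
  rw [hypMeasure, lintegral_map hh measurable_ofSpatial,
    lintegral_withDensity_eq_lintegral_mul _ hm (g := fun u => h (ofSpatial u))
      (hh.comp measurable_ofSpatial)]
  rfl

lemma eq_ofSpatial (x : Hyperboloid) : x = ofSpatial ![x.1 1, x.1 2, x.1 3] := by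
  have e : energy ![x.1 1, x.1 2, x.1 3] = x.1 0 := by
    have h := x.2.1
    simp only [energy, mink] at *
    rw [Real.sqrt_eq_iff_mul_self_eq (by positivity) x.2.2.le]
    simp
    linarith
  refine Subtype.ext (funext fun i => ?_)
  fin_cases i <;> simp [ofSpatial, e]

/-- Boosting both arguments leaves `mink` unchanged. With the other two coordinates of `u` frozen,
`energy u ^ 2 - u i ^ 2` is a constant `M`, and the boost of `u` becomes the one-dimensional change
of variables of `lintegral_boost_line`. -/
lemma lintegral_mink_boost {g : ℝ → ENNReal} (hg : Measurable g) (i : Fin 3) (η : ℝ)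
    (w : Fin 3 → ℝ) :
    ∫⁻ u, ENNReal.ofReal (1 / energy u) * g (mink (ofSpatial w).1 (ofSpatial u).1) =
      ∫⁻ u, ENNReal.ofReal (1 / energy u) *
        g (mink (ofSpatial (boost i η w)).1 (ofSpatial u).1) := by
  have hm : ∀ w, Measurable fun u => ENNReal.ofReal (1 / energy u) *
      g (mink (ofSpatial w).1 (ofSpatial u).1) := fun w =>
    (measurable_const.div measurable_energy).ennreal_ofReal.mul
      (hg.comp (measurable_mink_ofSpatial _))
  rw [volume_pi]
  refine lintegral_eq_of_lmarginal_eq {i} (hm w) (hm _) ?_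
  rw [lmarginal_singleton, lmarginal_singleton]
  funext x
  have hM : 0 < energy x ^ 2 - x i ^ 2 := by linarith [sq_lt_energy_sq x i]
  simp only [energy_update]
  refine Eq.trans ?_ (lintegral_boost_line hM η fun t =>
    g (mink (ofSpatial (boost i η w)).1 (ofSpatial (Function.update x i t)).1))
  refine lintegral_congr fun t => ?_
  have h : Function.update x i (Real.cosh η * t +
      Real.sinh η * √(energy x ^ 2 - x i ^ 2 + t ^ 2)) = boost i η (Function.update x i t) := by
    rw [boost, energy_update]
    simp
  rw [h, mink_boost]

/-- A function of the hyperbolic distance from a point integrates to a value that does not depend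
on the point. -/
lemma lintegral_mink {g : ℝ → ENNReal} (hg : Measurable g) (x : Hyperboloid) :
    ∫⁻ y, g (mink x.1 y.1) ∂hypMeasure = ∫⁻ u, ENNReal.ofReal (1 / energy u) * g (energy u) := by
  -- Applied once per axis, this moves the base point to the apex `(1, 0, 0, 0)`, where `mink` is
  -- the energy.
  have step : ∀ i w, ∫⁻ u, ENNReal.ofReal (1 / energy u) *
      g (mink (ofSpatial w).1 (ofSpatial u).1) = ∫⁻ u, ENNReal.ofReal (1 / energy u) *
        g (mink (ofSpatial (Function.update w i 0)).1 (ofSpatial u).1) := by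
    intro i w
    obtain ⟨η, h⟩ := exists_boost_eq_update_zero i w
    rw [lintegral_mink_boost hg i η w, h]
  have hmx : Measurable fun y : Hyperboloid => g (mink x.1 y.1) :=
    hg.comp (measurable_mink.comp (measurable_const.prodMk measurable_id))
  rw [lintegral_hypMeasure hmx, eq_ofSpatial x, step 0, step 1, step 2]
  refine lintegral_congr fun u => ?_
  rw [mink_ofSpatial]
  congr 2
  have h0 : Function.update (Function.update (Function.update ![x.1 1, x.1 2, x.1 3]
      (0 : Fin 3) (0 : ℝ)) 1 0) 2 0 = 0 := by
    funext i
    fin_cases i <;> simp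
  rw [h0]
  simp [energy]

/-- This is `(1 + w·u)² ≤ (1 + |w|²)(1 + |u|²)`: the difference is `|w - u|²` plus the
Cauchy–Schwarz defect of `w` and `u`. -/
lemma one_le_mink (x y : Hyperboloid) : 1 ≤ mink x.1 y.1 := by
  rw [eq_ofSpatial x, eq_ofSpatial y, mink_ofSpatial]
  generalize ![x.1 1, x.1 2, x.1 3] = w
  generalize ![y.1 1, y.1 2, y.1 3] = u
  have h1 := energy_sq w
  have h2 := energy_sq u
  have h3 := Finset.sum_mul_sq_le_sq_mul_sq Finset.univ w u
  have h4 : (1 + ∑ i, w i * u i) ^ 2 ≤ (energy w * energy u) ^ 2 := by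
    have h5 : 0 ≤ ∑ i, (w i - u i) ^ 2 := Finset.sum_nonneg fun i _ => sq_nonneg _
    have h6 : ∑ i, (w i - u i) ^ 2 = ∑ i, w i ^ 2 - 2 * ∑ i, w i * u i + ∑ i, u i ^ 2 := by
      rw [Finset.mul_sum, ← Finset.sum_sub_distrib, ← Finset.sum_add_distrib]
      exact Finset.sum_congr rfl fun i _ => by ring
    rw [mul_pow, h1, h2]
    nlinarith
  have := abs_le_of_sq_le_sq h4 (mul_pos (energy_pos w) (energy_pos u)).le
  linarith [le_abs_self (1 + ∑ i, w i * u i)]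

/-! ## A kernel with finite integral -/

/-- The majorant `cosh^{1/10} φ / sinh φ` of the kernels, as a function of `cosh φ`. -/
def majorant (c : ℝ) : ℝ := c ^ (1 / 10 : ℝ) / √(c ^ 2 - 1)

lemma measurable_majorant : Measurable majorant := by
  unfold majorant
  fun_prop

lemma majorant_nonneg {c : ℝ} (hc : 0 ≤ c) : 0 ≤ majorant c := by
  unfold majorant
  positivity

/-- With `ρ = sinh φ`, the `5/2`-th power of the majorant times the density `1 / energy` is
`energy^(1/4 - 1) ρ^(-5/2)`. Against `ρ² dρ` this is of order `ρ^(-1/2)` at zero and `ρ^(-5/4)` at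
infinity. Any exponent below `1/5` in place of `1/10` would still give convergence at infinity. -/
lemma integrableOn_radial : IntegrableOn
    (fun ρ : ℝ => ρ ^ (3 - 1) • (√(1 + ρ ^ 2) ^ (-(3 / 4) : ℝ) * ρ ^ (-(5 / 2) : ℝ)))
    (Set.Ioi 0) := by
  have hm : Measurable fun ρ : ℝ =>
      ρ ^ (3 - 1) • (√(1 + ρ ^ 2) ^ (-(3 / 4) : ℝ) * ρ ^ (-(5 / 2) : ℝ)) := by
    simp only [smul_eq_mul]
    fun_prop
  have heq : ∀ ρ : ℝ, 0 < ρ →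
      ρ ^ (3 - 1) • (√(1 + ρ ^ 2) ^ (-(3 / 4) : ℝ) * ρ ^ (-(5 / 2) : ℝ)) =
        √(1 + ρ ^ 2) ^ (-(3 / 4) : ℝ) * ρ ^ (-(1 / 2) : ℝ) := by
    intro ρ hρ
    have : ρ ^ (-(1 / 2) : ℝ) = ρ ^ 2 * ρ ^ (-(5 / 2) : ℝ) := by
      rw [← Real.rpow_natCast, ← Real.rpow_add hρ]
      norm_num
    rw [this, smul_eq_mul]
    ring
  rw [← Set.Ioc_union_Ioi_eq_Ioi zero_le_one]
  refine IntegrableOn.union ?_ ?_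
  · have h : IntegrableOn (fun ρ : ℝ => ρ ^ (-(1 / 2) : ℝ)) (Set.Ioc 0 1) := by
      rw [← intervalIntegrable_iff_integrableOn_Ioc_of_le zero_le_one]
      exact intervalIntegral.intervalIntegrable_rpow' (by norm_num)
    refine Integrable.mono' h hm.aestronglyMeasurable ?_
    refine (ae_restrict_iff' measurableSet_Ioc).2 (Filter.Eventually.of_forall fun ρ hρ => ?_)
    rw [heq ρ hρ.1, Real.norm_of_nonneg (mul_nonneg (by positivity)
      (Real.rpow_nonneg hρ.1.le _))]
    refine mul_le_of_le_one_left (Real.rpow_nonneg hρ.1.le _) ?_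
    refine Real.rpow_le_one_of_one_le_of_nonpos ?_ (by norm_num)
    rw [Real.one_le_sqrt]
    nlinarith
  · have h : IntegrableOn (fun ρ : ℝ => ρ ^ (-(5 / 4) : ℝ)) (Set.Ioi 1) :=
      integrableOn_Ioi_rpow_of_lt (by norm_num) zero_lt_one
    refine Integrable.mono' h hm.aestronglyMeasurable ?_
    refine (ae_restrict_iff' measurableSet_Ioi).2 (Filter.Eventually.of_forall fun ρ hρ => ?_)
    have hρ0 : 0 < ρ := zero_lt_one.trans hρ
    rw [heq ρ hρ0, Real.norm_of_nonneg (mul_nonneg (by positivity)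
      (Real.rpow_nonneg hρ0.le _)),
      show (-(5 / 4) : ℝ) = -(3 / 4) + -(1 / 2) by norm_num, Real.rpow_add hρ0]
    refine mul_le_mul_of_nonneg_right ?_ (Real.rpow_nonneg hρ0.le _)
    refine Real.rpow_le_rpow_of_nonpos hρ0 ?_ (by norm_num)
    exact Real.le_sqrt_of_sq_le (by linarith)

/-- The integral over the hyperboloid of the majorant to the power `5 / 2`. -/
def majorantConst : ENNReal :=
  ∫⁻ u, ENNReal.ofReal (1 / energy u) * ENNReal.ofReal (majorant (energy u) ^ (5 / 2 : ℝ))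

lemma majorantConst_lt_top : majorantConst < ⊤ := by
  -- Polar integration needs the Euclidean norm, whereas `Fin 3 → ℝ` carries the sup norm; the
  -- identification preserves volume.
  have h := (integrable_fun_norm_addHaar (volume : Measure (EuclideanSpace ℝ (Fin 3)))
    (f := fun ρ : ℝ => √(1 + ρ ^ 2) ^ (-(3 / 4) : ℝ) * ρ ^ (-(5 / 2) : ℝ))).2
    (by simpa using integrableOn_radial)
  rw [← (PiLp.volume_preserving_toLp (Fin 3)).integrable_comp_emb
    (MeasurableEquiv.toLp 2 _).measurableEmbedding] at h
  have h2 := h.lintegral_lt_top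
  refine lt_of_eq_of_lt ?_ h2
  refine lintegral_congr fun u => ?_
  have hE := energy_pos u
  have hn : ‖(WithLp.toLp 2 u : EuclideanSpace ℝ (Fin 3))‖ = √(energy u ^ 2 - 1) := by
    rw [EuclideanSpace.norm_eq, energy_sq]
    simp
  have hn2 : √(1 + √(energy u ^ 2 - 1) ^ 2) = energy u := by
    have : 0 ≤ energy u ^ 2 - 1 := by nlinarith [one_le_energy u]
    rw [Real.sq_sqrt this, add_sub_cancel, Real.sqrt_sq hE.le]
  rw [← ENNReal.ofReal_mul (by positivity), Function.comp_apply, hn, hn2, majorant,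
    Real.div_rpow (by positivity) (by positivity), ← Real.rpow_mul hE.le,
    Real.rpow_neg (Real.sqrt_nonneg _), show (-(3 / 4) : ℝ) = 1 / 10 * (5 / 2) + -1 by norm_num,
    Real.rpow_add hE, Real.rpow_neg_one]
  congr 1
  ring

lemma lintegral_majorant (x : Hyperboloid) :
    ∫⁻ y, ENNReal.ofReal (majorant (mink x.1 y.1) ^ (5 / 2 : ℝ)) ∂hypMeasure = majorantConst :=
  lintegral_mink (g := fun c => ENNReal.ofReal (majorant c ^ (5 / 2 : ℝ)))
    (measurable_majorant.pow_const _).ennreal_ofReal x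

/-! ## Integrals over stars -/

section Star

variable {ι X : Type*} [DecidableEq ι] [MeasurableSpace X] {μ : Measure X} [SigmaFinite μ]
  {T : X → X → ENNReal} {C : ENNReal}

/-- The leaves are integrated one at a time while the centre `κ x` stays put. The weight `w` holds
whatever is independent of the leaves and absorbs one factor `C` per step. Leaving `κ` general
covers both a fixed centre and a coordinate as centre. -/
lemma lmarginal_star_le (hT : Measurable (Function.uncurry T)) (hC : ∀ x, ∫⁻ y, T x y ∂μ ≤ C)
    {κ : (ι → X) → X} (hκ : Measurable κ) (s : Finset ι)
    (hκs : ∀ j ∈ s, ∀ x t, κ (Function.update x j t) = κ x)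
    {w : (ι → X) → ENNReal} (hw : Measurable w)
    (hws : ∀ j ∈ s, ∀ x t, w (Function.update x j t) = w x) :
    lmarginal (fun _ => μ) s (fun x => w x * ∏ j ∈ s, T (κ x) (x j)) ≤
      fun x => w x * C ^ s.card := by
  induction s using Finset.induction generalizing w with
  | empty => simp
  | insert j s hj ih =>
    have hTm : ∀ j, Measurable fun x : ι → X => T (κ x) (x j) := fun j =>
      hT.comp (hκ.prodMk (measurable_pi_apply j))
    have hm : Measurable fun x : ι → X => w x * ∏ j ∈ insert j s, T (κ x) (x j) :=
      hw.mul (Finset.measurable_prod _ fun j _ => hTm j)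
    rw [lmarginal_insert' _ hm hj]
    have h1 : (fun x => ∫⁻ t, w (Function.update x j t) *
        ∏ i ∈ insert j s, T (κ (Function.update x j t)) (Function.update x j t i) ∂μ) ≤
        fun x => (w x * C) * ∏ i ∈ s, T (κ x) (x i) := by
      intro x
      have h2 : ∀ t, w (Function.update x j t) *
          ∏ i ∈ insert j s, T (κ (Function.update x j t)) (Function.update x j t i) =
          (w x * ∏ i ∈ s, T (κ x) (x i)) * T (κ x) t := by
        intro t
        rw [hws j (Finset.mem_insert_self _ _), hκs j (Finset.mem_insert_self _ _),
          Finset.prod_insert hj, Function.update_self, mul_comm (T (κ x) t), mul_assoc]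
        congr 2
        refine Finset.prod_congr rfl fun i hi => ?_
        rw [Function.update_of_ne (ne_of_mem_of_not_mem hi hj)]
      simp only [h2]
      have hTx : Measurable (T (κ x)) := hT.comp (measurable_const.prodMk measurable_id)
      rw [lintegral_const_mul _ hTx]
      calc w x * (∏ i ∈ s, T (κ x) (x i)) * ∫⁻ t, T (κ x) t ∂μ
          ≤ w x * (∏ i ∈ s, T (κ x) (x i)) * C := by gcongr; exact hC _
        _ = w x * C * ∏ i ∈ s, T (κ x) (x i) := by ring
    refine (lmarginal_mono h1).trans ((ih (fun i hi => hκs i (Finset.mem_insert_of_mem hi))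
      (hw.mul_const C) (fun i hi x t => by rw [hws i (Finset.mem_insert_of_mem hi)])).trans ?_)
    intro x
    simp only
    rw [Finset.card_insert_of_notMem hj, pow_succ, mul_assoc, mul_comm C]

variable [Fintype ι]

lemma lintegral_star_const_le (hT : Measurable (Function.uncurry T))
    (hC : ∀ x, ∫⁻ y, T x y ∂μ ≤ C) (b : X) :
    ∫⁻ x : ι → X, ∏ j, T b (x j) ∂(Measure.pi fun _ => μ) ≤ C ^ Fintype.card ι := by
  rw [lintegral_eq_lmarginal_univ (fun _ => b)]
  have := lmarginal_star_le (ι := ι) hT hC (κ := fun _ => b) measurable_const Finset.univ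
    (fun _ _ _ _ => rfl) (w := fun _ => 1) measurable_const (fun _ _ _ _ => rfl) (fun _ => b)
  simpa using this

/-- Here the centre is itself integrated and the fixed point `b` is one of the leaves. Once the free
leaves are gone, symmetry of `T` turns the remaining edge to `b` into one more integral bounded by
`C`. -/
lemma lintegral_star_le (hT : Measurable (Function.uncurry T))
    (hC : ∀ x, ∫⁻ y, T x y ∂μ ≤ C) (hsymm : ∀ x y, T x y = T y x) (b : X) (i : ι) :
    ∫⁻ x : ι → X, T (x i) b * ∏ j ∈ Finset.univ.erase i, T (x i) (x j) ∂(Measure.pi fun _ => μ) ≤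
      C * C ^ (Finset.univ.erase i).card := by
  have hκ : Measurable fun x : ι → X => x i := measurable_pi_apply i
  have hw : Measurable fun x : ι → X => T (x i) b := hT.comp (hκ.prodMk measurable_const)
  have hup : ∀ j ∈ Finset.univ.erase i, ∀ (x : ι → X) t, Function.update x j t i = x i :=
    fun j hj x t => Function.update_of_ne (Finset.ne_of_mem_erase hj).symm _ _
  have hm : Measurable fun x : ι → X => T (x i) b * ∏ j ∈ Finset.univ.erase i, T (x i) (x j) :=
    hw.mul (Finset.measurable_prod _ fun j _ => hT.comp (hκ.prodMk (measurable_pi_apply j)))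
  rw [lintegral_eq_lmarginal_univ (fun _ => b), lmarginal_erase _ hm (Finset.mem_univ i)]
  have key := lmarginal_star_le hT hC hκ (Finset.univ.erase i) hup hw
    (fun j hj x t => by rw [hup j hj])
  refine (lintegral_mono fun t => key (Function.update (fun _ => b) i t)).trans ?_
  simp only [Function.update_self]
  have hTb : Measurable fun t => T t b := hT.comp (measurable_id.prodMk measurable_const)
  rw [lintegral_mul_const _ hTb]
  gcongr
  refine le_trans (le_of_eq ?_) (hC b)
  exact lintegral_congr fun t => hsymm _ _

end Star

/-! ## The simplices of a 4-simplex -/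

section Simplex

variable {V : Type*} [DecidableEq V] {K : AbstractSimplicialComplex V}

lemma card_inter_of_ne {v : DualVertex K} {e e' : DualEdge K} (he : e.1 ⊆ v.1) (he' : e'.1 ⊆ v.1)
    (hne : e ≠ e') : (e.1 ∩ e'.1).card = 3 := by
  have h1 := Finset.card_union_add_card_inter e.1 e'.1
  have h2 := Finset.card_le_card (Finset.union_subset he he')
  rw [v.2.2] at h2
  rw [e.2.2, e'.2.2] at h1
  have h3 : (e.1 ∩ e'.1).card ≠ 4 := by
    intro h
    have h4 := Finset.eq_of_subset_of_card_le (Finset.inter_subset_left : e.1 ∩ e'.1 ⊆ e.1)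
      (by rw [h, e.2.2])
    have h5 := Finset.eq_of_subset_of_card_le (Finset.inter_subset_right : e.1 ∩ e'.1 ⊆ e'.1)
      (by rw [h, e'.2.2])
    exact hne (Subtype.ext (h4.symm.trans h5))
  have h6 := Finset.card_le_card (Finset.inter_subset_left : e.1 ∩ e'.1 ⊆ e.1)
  rw [e.2.2] at h6
  omega

lemma mink_comm (x y : Fin 4 → ℝ) : mink x y = mink y x := by
  unfold mink
  ring

lemma Choices.measurable_val (c : Choices K) (v : DualVertex K) (e : DualEdge K) :
    Measurable fun x => c.val v x e := by
  unfold Choices.val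
  split_ifs with h
  · exact measurable_pi_apply _
  · exact measurable_const

variable [Fintype V]

lemma card_edges_of_dualVertex (v : DualVertex K) : #{e : DualEdge K | e.1 ⊆ v.1} = 5 := by
  have h : (Finset.powersetCard 4 v.1).card = 5 := by
    rw [Finset.card_powersetCard, v.2.2]; rfl
  refine (Finset.card_bij (fun f _ => f.1) ?_ ?_ ?_).trans h
  · intro f hf
    exact Finset.mem_powersetCard.2 ⟨(Finset.mem_filter.1 hf).2, f.2.2⟩
  · intro f _ f' _ h
    exact Subtype.ext h
  · intro s hs
    obtain ⟨h1, h2⟩ := Finset.mem_powersetCard.1 hs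
    exact ⟨⟨s, (K.isRelLowerSet_faces v.2.1).2 h1 (Finset.card_pos.1 (by omega)), h2⟩,
      by simp [h1], rfl⟩

/-- A tetrahedron between `f` and `v` is determined by its single vertex in the two-element set `v \
f`. -/
lemma Choices.edges_between (c : Choices K) {f : DualFace K} {v : DualVertex K}
    (hfv : f.1 ⊆ v.1) :
    ({e : DualEdge K | f.1 ⊆ e.1 ∧ e.1 ⊆ v.1} : Finset (DualEdge K)) =
      {c.ePlus f v, c.eMinus f v} := by
  symm
  refine Finset.eq_of_subset_of_card_le ?_ ?_
  · intro e he
    rw [Finset.mem_insert, Finset.mem_singleton] at he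
    rw [Finset.mem_filter]
    rcases he with rfl | rfl
    · exact ⟨Finset.mem_univ _, c.ePlus_spec f v hfv⟩
    · exact ⟨Finset.mem_univ _, c.eMinus_spec f v hfv⟩
  · rw [Finset.card_pair (c.ePlus_ne_eMinus f v hfv)]
    have h : (Finset.powersetCard 1 (v.1 \ f.1)).card = 2 := by
      rw [Finset.card_powersetCard, Finset.card_sdiff_of_subset hfv, v.2.2, f.2.2]; rfl
    refine le_trans (Finset.card_le_card_of_injOn (fun e => e.1 \ f.1) ?_ ?_) h.le
    · intro e he
      have he := (Finset.mem_filter.1 he).2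
      refine Finset.mem_powersetCard.2 ⟨Finset.sdiff_subset_sdiff he.2 subset_rfl, ?_⟩
      rw [Finset.card_sdiff_of_subset he.1, e.2.2, f.2.2]
    · intro e he e' he' h
      have he := (Finset.mem_filter.1 he).2
      have he' := (Finset.mem_filter.1 he').2
      apply Subtype.ext
      rw [← Finset.sdiff_union_of_subset he.1, ← Finset.sdiff_union_of_subset he'.1]
      simp only at h
      rw [h]

/-- The triangles of a tetrahedron `e` of a 4-simplex correspond to the other tetrahedra. -/
lemma Choices.prod_faces_eq_prod_edges (c : Choices K) {v : DualVertex K} {e : DualEdge K}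
    (he : e.1 ⊆ v.1) {M : Type*} [CommMonoid M] (N : DualEdge K → DualEdge K → M)
    (hN : ∀ a b, N a b = N b a) :
    ∏ f : DualFace K with f.1 ⊆ e.1, N (c.ePlus f v) (c.eMinus f v) =
      ∏ e' : DualEdge K with e'.1 ⊆ v.1 ∧ e' ≠ e, N e e' := by
  have pair : ∀ f : DualFace K, f.1 ⊆ v.1 → ∀ a : DualEdge K, f.1 ⊆ a.1 → a.1 ⊆ v.1 →
      a = c.ePlus f v ∨ a = c.eMinus f v := by
    intro f hf a h1 h2
    have : a ∈ ({c.ePlus f v, c.eMinus f v} : Finset (DualEdge K)) := by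
      rw [← c.edges_between hf]
      simp [h1, h2]
    simpa using this
  symm
  refine Finset.prod_bij (fun e' he' => ⟨e.1 ∩ e'.1, ?_, ?_⟩) ?_ ?_ ?_ ?_
  · have he' := (Finset.mem_filter.1 he').2
    refine (K.isRelLowerSet_faces e.2.1).2 Finset.inter_subset_left (Finset.card_pos.1 ?_)
    rw [card_inter_of_ne he he'.1 he'.2.symm]
    norm_num
  · have he' := (Finset.mem_filter.1 he').2
    exact card_inter_of_ne he he'.1 he'.2.symm
  · intro e' he'
    simp
  · intro a ha b hb h
    have ha := (Finset.mem_filter.1 ha).2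
    have hb := (Finset.mem_filter.1 hb).2
    have hi := congrArg Subtype.val h
    simp only at hi
    have hca := card_inter_of_ne he ha.1 ha.2.symm
    let f : DualFace K := ⟨e.1 ∩ a.1, (K.isRelLowerSet_faces e.2.1).2 Finset.inter_subset_left
      (Finset.card_pos.1 (by omega)), hca⟩
    have hfv : f.1 ⊆ v.1 := Finset.inter_subset_left.trans he
    have h1 := pair f hfv e Finset.inter_subset_left he
    have h2 := pair f hfv a Finset.inter_subset_right ha.1
    have h3 := pair f hfv b (hi ▸ Finset.inter_subset_right : e.1 ∩ a.1 ⊆ b.1) hb.1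
    have := ha.2
    have := hb.2
    grind
  · intro f hf
    have hf := (Finset.mem_filter.1 hf).2
    have hfv := hf.trans he
    have hp := c.ePlus_spec f v hfv
    have hm := c.eMinus_spec f v hfv
    have hne := c.ePlus_ne_eMinus f v hfv
    have key : ∀ e' : DualEdge K, f.1 ⊆ e'.1 → e'.1 ⊆ v.1 → e' ≠ e → e.1 ∩ e'.1 = f.1 := by
      intro e' h1 h2 h3
      refine (Finset.eq_of_subset_of_card_le (Finset.subset_inter hf h1) ?_).symm
      rw [card_inter_of_ne he h2 h3.symm, f.2.2]
    rcases pair f hfv e hf he with h | h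
    · have hne' : c.eMinus f v ≠ e := fun h' => hne (h.symm.trans h'.symm)
      exact ⟨c.eMinus f v, by simp [hm.2, hne'], Subtype.ext (key _ hm.1 hm.2 hne')⟩
    · have hne' : c.ePlus f v ≠ e := fun h' => hne (h'.trans h)
      exact ⟨c.ePlus f v, by simp [hp.2, hne'], Subtype.ext (key _ hp.1 hp.2 hne')⟩
  · intro e' he'
    have he' := (Finset.mem_filter.1 he').2
    generalize_proofs p1
    set f : DualFace K := ⟨e.1 ∩ e'.1, p1⟩
    have hfv : f.1 ⊆ v.1 := Finset.inter_subset_left.trans he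
    have h1 := pair f hfv e Finset.inter_subset_left he
    have h2 := pair f hfv e' Finset.inter_subset_right he'.1
    rcases h1 with h1 | h1 <;> rcases h2 with h2 | h2
    · exact absurd (h2.trans h1.symm) he'.2
    · rw [← h1, ← h2]
    · rw [← h1, ← h2, hN]
    · exact absurd (h2.trans h1.symm) he'.2

/-- A product over the ten triangles of a 4-simplex is bounded by the sum over its five tetrahedra
of the products over their triangles, to the power `5 / 2`. -/
lemma Choices.prod_le_sum_prod_rpow (c : Choices K) (v : DualVertex K) {M : DualFace K → ℝ}
    (hM : ∀ f, 0 ≤ M f) :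
    ∏ f : DualFace K with f.1 ⊆ v.1, M f ≤
      ∑ e : DualEdge K with e.1 ⊆ v.1, ∏ f : DualFace K with f.1 ⊆ e.1, M f ^ (5 / 2 : ℝ) := by
  have hP : ∀ e : DualEdge K, 0 ≤ ∏ f : DualFace K with f.1 ⊆ e.1, M f ^ (5 / 2 : ℝ) := fun e =>
    Finset.prod_nonneg fun f _ => Real.rpow_nonneg (hM f) _
  -- Equal weights `1/5` on the five tetrahedra. Each triangle lies in two of them, so the geometric
  -- mean carries `M f` to the power `2 · (5/2) · (1/5) = 1`.
  have h := Real.geom_mean_le_arith_mean_weighted ({e : DualEdge K | e.1 ⊆ v.1} : Finset _)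
    (fun _ => (1 / 5 : ℝ)) (fun e => ∏ f : DualFace K with f.1 ⊆ e.1, M f ^ (5 / 2 : ℝ))
    (fun _ _ => by norm_num)
    (by rw [Finset.sum_const, card_edges_of_dualVertex]; norm_num) (fun e _ => hP e)
  have h1 : ∏ e : DualEdge K with e.1 ⊆ v.1,
      (∏ f : DualFace K with f.1 ⊆ e.1, M f ^ (5 / 2 : ℝ)) ^ (1 / 5 : ℝ) =
      ∏ f : DualFace K with f.1 ⊆ v.1, M f := by
    have h2 : ∀ e : DualEdge K, (∏ f : DualFace K with f.1 ⊆ e.1, M f ^ (5 / 2 : ℝ)) ^ (1 / 5 : ℝ) =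
        ∏ f : DualFace K with f.1 ⊆ e.1, M f ^ (1 / 2 : ℝ) := by
      intro e
      rw [← Real.finsetProd_rpow _ _ fun f _ => Real.rpow_nonneg (hM f) _]
      refine Finset.prod_congr rfl fun f _ => ?_
      rw [← Real.rpow_mul (hM f)]
      norm_num
    simp only [h2]
    rw [Finset.prod_comm' (s' := fun f => {e : DualEdge K | f.1 ⊆ e.1 ∧ e.1 ⊆ v.1})
      (t' := {f : DualFace K | f.1 ⊆ v.1})]
    · refine Finset.prod_congr rfl fun f hf => ?_
      have hf := (Finset.mem_filter.1 hf).2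
      rw [c.edges_between hf, Finset.prod_const, Finset.card_pair (c.ePlus_ne_eMinus f v hf),
        ← Real.rpow_natCast, ← Real.rpow_mul (hM f)]
      norm_num
    · intro e f
      simp only [Finset.mem_filter, Finset.mem_univ, true_and]
      exact ⟨fun h => ⟨⟨h.2, h.1⟩, h.2.trans h.1⟩, fun h => ⟨h.1.2, h.1.1⟩⟩
  rw [h1] at h
  refine h.trans (Finset.sum_le_sum fun e _ => ?_)
  linarith [hP e]

/-! ## The integral over the variables at a dual vertex -/

/-- The majorant of the kernel, to the power `5 / 2`. -/
def starKernel (x y : Hyperboloid) : ENNReal :=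
  ENNReal.ofReal (majorant (mink x.1 y.1) ^ (5 / 2 : ℝ))

lemma measurable_majorant_comp {α : Type*} [MeasurableSpace α] {f g : α → Hyperboloid}
    (hf : Measurable f) (hg : Measurable g) :
    Measurable fun x => majorant (mink (f x).1 (g x).1) :=
  measurable_majorant.comp (measurable_mink.comp (hf.prodMk hg))

lemma measurable_starKernel_comp {α : Type*} [MeasurableSpace α] {f g : α → Hyperboloid}
    (hf : Measurable f) (hg : Measurable g) : Measurable fun x => starKernel (f x) (g x) := by
  unfold starKernel
  exact ((measurable_majorant_comp hf hg).pow_const _).ennreal_ofReal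

lemma measurable_starKernel : Measurable (Function.uncurry starKernel) :=
  measurable_starKernel_comp measurable_fst measurable_snd

/-- The star has four edges. Its centre is either the fixed variable, leaving four free leaves, or a
free one, in which case the fixed variable is a leaf. -/
lemma Choices.lintegral_star_lt_top (c : Choices K) (v : DualVertex K) {e : DualEdge K}
    (he : e.1 ⊆ v.1) :
    ∫⁻ x, ∏ e' : DualEdge K with e'.1 ⊆ v.1 ∧ e' ≠ e, starKernel (c.val v x e) (c.val v x e')
      ∂(c.vertexMeasure v) < ⊤ := by
  have hC : ∀ x, ∫⁻ y, starKernel x y ∂hypMeasure ≤ majorantConst := fun x =>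
    (lintegral_majorant x).le
  have hsymm : ∀ x y, starKernel x y = starKernel y x := fun x y => by
    rw [starKernel, starKernel, mink_comm]
  have htop : majorantConst ≠ ⊤ := majorantConst_lt_top.ne
  have hval : ∀ (x : c.VertexConfig v) (j : c.FreeEdge v), c.val v x j.1 = x j := fun x j => by
    simp [Choices.val, j.2]
  have hbase : ∀ x : c.VertexConfig v, c.val v x (c.e₀ v) = c.base v := fun x => by
    simp [Choices.val]
  unfold Choices.vertexMeasure
  by_cases h0 : e = c.e₀ v
  · subst h0
    refine lt_of_le_of_lt (le_of_eq_of_le ?_ (lintegral_star_const_le (ι := c.FreeEdge v)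
      measurable_starKernel hC (c.base v))) (ENNReal.pow_lt_top htop.lt_top)
    refine lintegral_congr fun x => ?_
    symm
    refine Finset.prod_bij (fun j _ => j.1) (fun j _ => by simp [j.2])
      (fun _ _ _ _ h => Subtype.ext h) (fun e' he' => ?_) (fun j _ => by rw [hval, hbase])
    exact ⟨⟨e', (Finset.mem_filter.1 he').2⟩, Finset.mem_univ _, rfl⟩
  · set i : c.FreeEdge v := ⟨e, he, h0⟩
    refine lt_of_le_of_lt (le_of_eq_of_le ?_ (lintegral_star_le (ι := c.FreeEdge v)
      measurable_starKernel hC hsymm (c.base v) i))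
      (ENNReal.mul_lt_top htop.lt_top (ENNReal.pow_lt_top htop.lt_top))
    refine lintegral_congr fun x => ?_
    have hmem : c.e₀ v ∈ ({e' : DualEdge K | e'.1 ⊆ v.1 ∧ e' ≠ e} : Finset _) := by
      simp [c.e₀_subset v, Ne.symm h0]
    rw [← Finset.mul_prod_erase _ _ hmem, hbase, show c.val v x e = x i from hval x i]
    congr 1
    symm
    refine Finset.prod_bij (fun j _ => j.1) (fun j hj => ?_)
      (fun _ _ _ _ h => Subtype.ext h) (fun e' he' => ?_) (fun j _ => by rw [hval])
    · have := Finset.ne_of_mem_erase hj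
      simp only [Finset.mem_erase, Finset.mem_filter, Finset.mem_univ, true_and]
      exact ⟨j.2.2, j.2.1, fun h => this (Subtype.ext h)⟩
    · simp only [Finset.mem_erase, Finset.mem_filter, Finset.mem_univ, true_and] at he'
      exact ⟨⟨e', he'.2.1, he'.1⟩, by simp [i, he'.2.2], rfl⟩

/-- The triangles of `v` are the edges of the complete graph on its five tetrahedra. The product
over this graph does not factor under integration, but the stars bounding it do. -/
lemma Choices.integrable_prod_majorant (c : Choices K) (v : DualVertex K) :
    Integrable (fun x => ∏ f : DualFace K with f.1 ⊆ v.1,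
      majorant (mink (c.val v x (c.ePlus f v)).1 (c.val v x (c.eMinus f v)).1))
      (c.vertexMeasure v) := by
  have hm : ∀ e e' : DualEdge K, Measurable fun x : c.VertexConfig v =>
      starKernel (c.val v x e) (c.val v x e') := fun e e' =>
    measurable_starKernel_comp (c.measurable_val v e) (c.measurable_val v e')
  have hpos : ∀ x y : Hyperboloid, 0 ≤ majorant (mink x.1 y.1) := fun x y =>
    majorant_nonneg (zero_le_one.trans (one_le_mink x y))
  have hM : Measurable fun x : c.VertexConfig v => ∏ f : DualFace K with f.1 ⊆ v.1,
      majorant (mink (c.val v x (c.ePlus f v)).1 (c.val v x (c.eMinus f v)).1) :=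
    Finset.measurable_prod _ fun f _ =>
      measurable_majorant_comp (c.measurable_val v _) (c.measurable_val v _)
  refine ⟨hM.aestronglyMeasurable, ?_⟩
  rw [hasFiniteIntegral_iff_ofReal (Filter.Eventually.of_forall fun x =>
    Finset.prod_nonneg fun f _ => hpos _ _)]
  calc ∫⁻ x, ENNReal.ofReal (∏ f : DualFace K with f.1 ⊆ v.1,
        majorant (mink (c.val v x (c.ePlus f v)).1 (c.val v x (c.eMinus f v)).1))
        ∂(c.vertexMeasure v)
      ≤ ∫⁻ x, ∑ e : DualEdge K with e.1 ⊆ v.1, ∏ e' : DualEdge K with e'.1 ⊆ v.1 ∧ e' ≠ e,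
          starKernel (c.val v x e) (c.val v x e') ∂(c.vertexMeasure v) := by
        refine lintegral_mono fun x => ?_
        refine (ENNReal.ofReal_le_ofReal
          (c.prod_le_sum_prod_rpow v (fun f => hpos _ _))).trans (le_of_eq ?_)
        rw [ENNReal.ofReal_sum_of_nonneg fun e _ => Finset.prod_nonneg fun f _ =>
          Real.rpow_nonneg (hpos _ _) _]
        refine Finset.sum_congr rfl fun e he => ?_
        rw [ENNReal.ofReal_prod_of_nonneg fun f _ => Real.rpow_nonneg (hpos _ _) _]
        exact c.prod_faces_eq_prod_edges (Finset.mem_filter.1 he).2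
          (fun a b => starKernel (c.val v x a) (c.val v x b))
          fun a b => by simp only [starKernel]; rw [mink_comm]
    _ = ∑ e : DualEdge K with e.1 ⊆ v.1, ∫⁻ x, ∏ e' : DualEdge K with e'.1 ⊆ v.1 ∧ e' ≠ e,
          starKernel (c.val v x e) (c.val v x e') ∂(c.vertexMeasure v) :=
        lintegral_finsetSum _ fun e _ => Finset.measurable_prod _ fun e' _ => hm e e'
    _ < ⊤ := ENNReal.sum_lt_top.2 fun e he =>
        c.lintegral_star_lt_top v (Finset.mem_filter.1 he).2

end Simplex

/-! ## Elementary estimates -/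

/-- The function `a ↦ a^{1/3} + a`. It dominates `|sin (p a)|` up to the factors `p` and
`p^{1/3}`. -/
def gauge (a : ℝ) : ℝ := a ^ (1 / 3 : ℝ) + a

lemma measurable_gauge : Measurable gauge := by
  unfold gauge
  fun_prop

lemma gauge_nonneg {a : ℝ} (ha : 0 ≤ a) : 0 ≤ gauge a := by
  unfold gauge
  positivity

lemma abs_sin_le_mul_gauge {p : ℝ} (hp : 0 ≤ p) (a : ℝ) :
    |Real.sin (p * a)| ≤ p * gauge |a| := by
  have h1 : |Real.sin (p * a)| ≤ |p * a| := Real.abs_sin_le_abs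
  rw [abs_mul, abs_of_nonneg hp] at h1
  refine h1.trans (mul_le_mul_of_nonneg_left ?_ hp)
  unfold gauge
  have := Real.rpow_nonneg (abs_nonneg a) (1 / 3 : ℝ)
  linarith

/-- From `min (t, 1) ≤ t^s` with `s = 1/3`. The choice balances two needs: `n s - (n - 2) < -1` for
all `n ≥ 6`, for large spins, requires `s < 1/2`, and `4 s - 2 > -1`, for the edge integrals at `r =
0`, requires `s > 1/4`. -/
lemma abs_sin_le_rpow_mul_gauge {p : ℝ} (hp : 0 ≤ p) (a : ℝ) :
    |Real.sin (p * a)| ≤ p ^ (1 / 3 : ℝ) * gauge |a| := by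
  have h2 : |Real.sin (p * a)| ≤ (p * |a|) ^ (1 / 3 : ℝ) := by
    have h0 : 0 ≤ p * |a| := mul_nonneg hp (abs_nonneg a)
    rcases le_total (p * |a|) 1 with h | h
    · have h1 : |Real.sin (p * a)| ≤ |p * a| := Real.abs_sin_le_abs
      rw [abs_mul, abs_of_nonneg hp] at h1
      exact h1.trans (Real.self_le_rpow_of_le_one h0 h (by norm_num))
    · exact (Real.abs_sin_le_one _).trans (Real.one_le_rpow h (by norm_num))
  refine h2.trans ?_
  rw [Real.mul_rpow hp (abs_nonneg a)]
  refine mul_le_mul_of_nonneg_left ?_ (Real.rpow_nonneg hp _)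
  unfold gauge
  linarith [abs_nonneg a]

lemma exp_div_four_le_sinh {r : ℝ} (hr : 1 ≤ r) : Real.exp r / 4 ≤ Real.sinh r := by
  have h1 : 2 ≤ Real.exp r := by linarith [Real.add_one_le_exp r]
  have h2 : Real.exp (-r) ≤ 1 := Real.exp_le_one_iff.2 (by linarith)
  rw [Real.sinh_eq]
  linarith

/-- Cubic growth is enough: against `gauge r ^ 4`, of order `r^4`, the factor `sinh^(-2)` then
leaves `r^(-2)`. -/
lemma pow_three_le_sinh {r : ℝ} (hr : 1 ≤ r) : r ^ 3 / 24 ≤ Real.sinh r := by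
  have h := Real.pow_div_factorial_le_exp r (by linarith) 3
  have h2 := exp_div_four_le_sinh hr
  simp only [Nat.factorial] at h
  norm_num at h
  linarith

/-- The majorant of the eye diagram. -/
def eyeMajorant (r : ℝ) : ℝ := 2 / (π * Real.sinh r ^ 2) * gauge r ^ 4

lemma eyeMajorant_nonneg {r : ℝ} (hr : 0 ≤ r) : 0 ≤ eyeMajorant r := by
  have := gauge_nonneg hr
  unfold eyeMajorant
  positivity

/-- On `(0, 1]` the term `r^(1/3)` dominates the gauge and `sinh r ≥ r`, leaving `r^(4/3 - 2)`;
beyond `1` the linear term dominates and the cubic bound on `sinh` applies. -/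
lemma integrableOn_eyeMajorant : IntegrableOn eyeMajorant (Set.Ioi 0) := by
  have hm : Measurable eyeMajorant := by
    unfold eyeMajorant gauge
    fun_prop
  have hπ := Real.pi_gt_three
  rw [← Set.Ioc_union_Ioi_eq_Ioi zero_le_one]
  refine IntegrableOn.union ?_ ?_
  · have h : IntegrableOn (fun r : ℝ => 16 * r ^ (-(2 / 3) : ℝ)) (Set.Ioc 0 1) := by
      refine Integrable.const_mul ?_ _
      rw [← IntegrableOn, ← intervalIntegrable_iff_integrableOn_Ioc_of_le zero_le_one]
      exact intervalIntegral.intervalIntegrable_rpow' (by norm_num)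
    refine Integrable.mono' h hm.aestronglyMeasurable ?_
    refine (ae_restrict_iff' measurableSet_Ioc).2 (Filter.Eventually.of_forall fun r hr => ?_)
    have hr0 := hr.1
    rw [Real.norm_of_nonneg (eyeMajorant_nonneg hr0.le)]
    have hs : r ≤ Real.sinh r := Real.self_le_sinh_iff.2 hr0.le
    have hg : gauge r ≤ 2 * r ^ (1 / 3 : ℝ) := by
      have := Real.self_le_rpow_of_le_one hr0.le hr.2 (by norm_num : (1 / 3 : ℝ) ≤ 1)
      unfold gauge
      linarith
    have e : (r ^ (1 / 3 : ℝ)) ^ 4 = r ^ (-(2 / 3) : ℝ) * r ^ 2 := by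
      rw [← Real.rpow_natCast, ← Real.rpow_natCast, ← Real.rpow_mul hr0.le, ← Real.rpow_add hr0]
      norm_num
    calc eyeMajorant r ≤ 2 / (2 * r ^ 2) * (2 * r ^ (1 / 3 : ℝ)) ^ 4 := by
          have := gauge_nonneg hr0.le
          unfold eyeMajorant
          gcongr
          linarith
      _ = 16 * r ^ (-(2 / 3) : ℝ) := by
          rw [mul_pow, e]
          field_simp
          norm_num
  · have h : IntegrableOn (fun r : ℝ => 16 * 24 ^ 2 * r ^ (-2 : ℝ)) (Set.Ioi 1) :=
      (integrableOn_Ioi_rpow_of_lt (by norm_num) zero_lt_one).const_mul _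
    refine Integrable.mono' h hm.aestronglyMeasurable ?_
    refine (ae_restrict_iff' measurableSet_Ioi).2 (Filter.Eventually.of_forall fun r hr => ?_)
    have hr1 : 1 ≤ r := le_of_lt hr
    have hr0 : 0 < r := zero_lt_one.trans hr
    rw [Real.norm_of_nonneg (eyeMajorant_nonneg hr0.le)]
    have hs := pow_three_le_sinh hr1
    have hg : gauge r ≤ 2 * r := by
      have := Real.rpow_le_self_of_one_le hr1 (by norm_num : (1 / 3 : ℝ) ≤ 1)
      unfold gauge
      linarith
    calc eyeMajorant r ≤ 2 / (2 * (r ^ 3 / 24) ^ 2) * (2 * r) ^ 4 := by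
          have := gauge_nonneg hr0.le
          unfold eyeMajorant
          gcongr
          linarith
      _ = 16 * 24 ^ 2 * r ^ (-2 : ℝ) := by
          rw [Real.rpow_neg hr0.le, Real.rpow_two]
          field_simp
          norm_num

lemma gauge_le_cosh {a : ℝ} (ha : 0 ≤ a) : gauge a ≤ 40 * Real.cosh a ^ (1 / 10 : ℝ) := by
  have h1 : a ^ (1 / 3 : ℝ) ≤ 1 + a := by
    rcases le_total a 1 with h | h
    · linarith [Real.rpow_le_one ha h (by norm_num : (0 : ℝ) ≤ 1 / 3)]
    · linarith [Real.rpow_le_self_of_one_le h (by norm_num : (1 / 3 : ℝ) ≤ 1)]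
  -- The constant: `gauge a ≤ 1 + 2 a ≤ 20 (a / 10 + 1) ≤ 20 exp(a)^(1/10)`, and `exp a ≤ 2 cosh a`
  -- costs at most another factor `2`.
  have h2 : a / 10 + 1 ≤ Real.exp a ^ (1 / 10 : ℝ) := by
    rw [← Real.exp_mul, mul_one_div]
    exact Real.add_one_le_exp _
  have h3 : Real.exp a ^ (1 / 10 : ℝ) ≤ (2 * Real.cosh a) ^ (1 / 10 : ℝ) := by
    refine Real.rpow_le_rpow (Real.exp_pos a).le ?_ (by norm_num)
    rw [Real.cosh_eq]
    linarith [Real.exp_pos (-a)]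
  rw [Real.mul_rpow (by norm_num) (Real.cosh_pos a).le] at h3
  have h4 : (2 : ℝ) ^ (1 / 10 : ℝ) ≤ 2 := by
    exact Real.rpow_le_self_of_one_le (by norm_num) (by norm_num)
  have h5 := mul_le_mul_of_nonneg_right h4
    (Real.rpow_nonneg (Real.cosh_pos a).le (1 / 10 : ℝ))
  unfold gauge
  linarith

lemma hdist_nonneg (x y : Hyperboloid) : 0 ≤ hdist x y := Real.arcosh_nonneg (one_le_mink x y)

lemma gauge_div_sinh_nonneg (x y : Hyperboloid) :
    0 ≤ gauge (hdist x y) / Real.sinh (hdist x y) :=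
  div_nonneg (gauge_nonneg (hdist_nonneg x y)) (Real.sinh_nonneg_iff.2 (hdist_nonneg x y))

lemma gauge_div_sinh_le (x y : Hyperboloid) :
    gauge (hdist x y) / Real.sinh (hdist x y) ≤ 40 * majorant (mink x.1 y.1) := by
  have h := one_le_mink x y
  have h1 := gauge_le_cosh (hdist_nonneg x y)
  unfold hdist at *
  rw [Real.cosh_arcosh h] at h1
  rw [Real.sinh_arcosh h, majorant, ← mul_div_assoc]
  gcongr

lemma measurable_hdist_comp {α : Type*} [MeasurableSpace α] {f g : α → Hyperboloid}
    (hf : Measurable f) (hg : Measurable g) : Measurable fun x => hdist (f x) (g x) := by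
  have h : Measurable fun x => mink (f x).1 (g x).1 := measurable_mink.comp (hf.prodMk hg)
  unfold hdist Real.arcosh
  fun_prop

lemma abs_kernel_le {p : ℝ} (hp : 0 < p) (x y : Hyperboloid) :
    |kernel p x y| ≤ gauge (hdist x y) / Real.sinh (hdist x y) := by
  have hφ := hdist_nonneg x y
  have hs := Real.sinh_nonneg_iff.2 hφ
  have h := abs_sin_le_mul_gauge hp.le (hdist x y)
  rw [abs_of_nonneg hφ] at h
  rw [kernel, abs_div, abs_mul, abs_of_pos hp, abs_of_nonneg hs]
  calc |Real.sin (p * hdist x y)| / (p * Real.sinh (hdist x y))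
      ≤ p * gauge (hdist x y) / (p * Real.sinh (hdist x y)) := by gcongr
    _ = gauge (hdist x y) / Real.sinh (hdist x y) := mul_div_mul_left _ _ hp.ne'

/-- The exponent `n/3 - (n - 2) = 2 - 2n/3` is at most `-2` exactly when `n ≥ 6`; this is where the
degree bound enters the analysis. -/
lemma rpow_pow_div_pow_le {p : ℝ} (hp : 1 ≤ p) {n : ℕ} (hn : 6 ≤ n) :
    (p ^ (1 / 3 : ℝ)) ^ n / p ^ ((n : ℤ) - 2) ≤ (p ^ 2)⁻¹ := by
  have hp0 : 0 < p := zero_lt_one.trans_le hp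
  have hn' : (6 : ℝ) ≤ n := by exact_mod_cast hn
  rw [← Real.rpow_natCast, ← Real.rpow_mul hp0.le, ← Real.rpow_intCast, ← Real.rpow_sub hp0,
    ← Real.rpow_natCast, ← Real.rpow_neg hp0.le]
  refine Real.rpow_le_rpow_of_exponent_le hp ?_
  push_cast
  linarith

variable {V : Type*} [DecidableEq V] {K : AbstractSimplicialComplex V}

/-! ### Bounds on the face factors -/

namespace Choices

variable (c : Choices K)

lemma phi_nonneg (f : DualFace K) (v : DualVertex K) (x : c.VertexConfig v) : 0 ≤ c.phi f v x :=
  hdist_nonneg _ _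

lemma measurable_phi (f : DualFace K) (v : DualVertex K) : Measurable (c.phi f v) :=
  measurable_hdist_comp (c.measurable_val v _) (c.measurable_val v _)

variable [Fintype V]

/-- The product of the gauges of the arguments of the sines in a face factor. -/
def faceGauge (f : DualFace K) (r : DualEdge K → ℝ) (x : c.HypConfig) : ℝ :=
  (∏ v : DualVertex K with f.1 ⊆ v.1, gauge (c.phi f v (x v))) *
    ∏ e : DualEdge K with f.1 ⊆ e.1, gauge |r e|

lemma faceGauge_nonneg (f : DualFace K) (r : DualEdge K → ℝ) (x : c.HypConfig) :
    0 ≤ c.faceGauge f r x :=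
  mul_nonneg (Finset.prod_nonneg fun _ _ => gauge_nonneg (c.phi_nonneg _ _ _))
    (Finset.prod_nonneg fun _ _ => gauge_nonneg (abs_nonneg _))

lemma abs_faceFactor_le {f : DualFace K} (hf : 6 ≤ degV f + degE f) (r : DualEdge K → ℝ)
    (x : c.HypConfig) {p : ℝ} (hp : 0 < p) :
    |c.faceFactor f r x p| ≤ c.faceGauge f r x * (2 * (1 + p ^ 2)⁻¹) := by
  have hG := c.faceGauge_nonneg f r x
  set n := degV f + degE f with hn
  have hexp : (degV f : ℤ) + (degE f : ℤ) - 2 = (n : ℤ) - 2 := by rw [hn]; push_cast; ring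
  -- The factor `q` taken out of each of the `n` sines is `p` when `p ≤ 1` and `p^(1/3)` when `p ≥
  -- 1`.
  have key : ∀ q : ℝ, 0 ≤ q → (∀ a, |Real.sin (p * a)| ≤ q * gauge |a|) →
      |c.faceFactor f r x p| ≤ c.faceGauge f r x * (q ^ n / p ^ ((n : ℤ) - 2)) := by
    intro q hq h
    have h1 : ∏ v : DualVertex K with f.1 ⊆ v.1, |Real.sin (p * c.phi f v (x v))| ≤
        q ^ degV f * ∏ v : DualVertex K with f.1 ⊆ v.1, gauge (c.phi f v (x v)) := by
      rw [degV, ← Finset.prod_const, ← Finset.prod_mul_distrib]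
      refine Finset.prod_le_prod (fun _ _ => abs_nonneg _) fun v _ => ?_
      have := h (c.phi f v (x v))
      rwa [abs_of_nonneg (c.phi_nonneg _ _ _)] at this
    have h2 : ∏ e : DualEdge K with f.1 ⊆ e.1, |Real.sin (p * r e)| ≤
        q ^ degE f * ∏ e : DualEdge K with f.1 ⊆ e.1, gauge |r e| := by
      rw [degE, ← Finset.prod_const, ← Finset.prod_mul_distrib]
      exact Finset.prod_le_prod (fun _ _ => abs_nonneg _) fun e _ => h (r e)
    have hpz : 0 < p ^ ((n : ℤ) - 2) := zpow_pos hp _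
    rw [faceFactor, hexp, abs_div, abs_mul, Finset.abs_prod, Finset.abs_prod, abs_of_pos hpz,
      ← mul_div_assoc]
    refine div_le_div_of_nonneg_right ?_ hpz.le
    refine (mul_le_mul h1 h2 (Finset.prod_nonneg fun _ _ => abs_nonneg _) ?_).trans_eq ?_
    · exact mul_nonneg (pow_nonneg hq _)
        (Finset.prod_nonneg fun _ _ => gauge_nonneg (c.phi_nonneg _ _ _))
    · rw [faceGauge, hn, pow_add]
      ring
  rcases le_total p 1 with h | h
  · refine (key p hp.le (abs_sin_le_mul_gauge hp.le)).trans (mul_le_mul_of_nonneg_left ?_ hG)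
    rw [← zpow_natCast, ← zpow_sub₀ hp.ne', show (n : ℤ) - (n - 2) = (2 : ℕ) by push_cast; ring,
      zpow_natCast, ← div_eq_mul_inv, le_div_iff₀ (by positivity)]
    nlinarith [pow_le_one₀ (n := 2) hp.le h, sq_nonneg p]
  · refine (key _ (Real.rpow_nonneg hp.le _) (abs_sin_le_rpow_mul_gauge hp.le)).trans
      (mul_le_mul_of_nonneg_left ((rpow_pow_div_pow_le h hf).trans ?_) hG)
    rw [← div_eq_mul_inv, inv_eq_one_div, div_le_div_iff₀ (by positivity) (by positivity)]
    nlinarith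

lemma measurable_faceFactor (f : DualFace K) (r : DualEdge K → ℝ) (x : c.HypConfig) :
    Measurable (c.faceFactor f r x) := by
  have h : ∀ a : ℝ, Measurable fun p : ℝ => Real.sin (p * a) := fun a =>
    Real.measurable_sin.comp (measurable_id.mul_const a)
  refine Measurable.div (Measurable.mul ?_ ?_) (measurable_id.pow_const _)
  · exact Finset.measurable_prod _ fun v _ => h _
  · exact Finset.measurable_prod _ fun e _ => h _

lemma integrableOn_faceFactor {f : DualFace K} (hf : 6 ≤ degV f + degE f)
    (r : DualEdge K → ℝ) (x : c.HypConfig) : IntegrableOn (c.faceFactor f r x) (Set.Ioi 0) := by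
  have hb : IntegrableOn (fun p : ℝ => c.faceGauge f r x * (2 * (1 + p ^ 2)⁻¹)) (Set.Ioi 0) :=
    ((integrable_inv_one_add_sq.const_mul 2).const_mul _).integrableOn
  refine Integrable.mono' hb (c.measurable_faceFactor f r x).aestronglyMeasurable ?_
  exact (ae_restrict_iff' measurableSet_Ioi).2
    (Filter.Eventually.of_forall fun p hp => c.abs_faceFactor_le hf r x hp)

/-! ## Face factoring -/

lemma prod_edges_comm {M : Type*} [CommMonoid M] (g : DualEdge K → DualFace K → M) :
    ∏ e : DualEdge K, ∏ f : DualFace K with f.1 ⊆ e.1, g e f =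
      ∏ f : DualFace K, ∏ e : DualEdge K with f.1 ⊆ e.1, g e f :=
  Finset.prod_comm' fun e f => by simp

lemma prod_vertices_comm {M : Type*} [CommMonoid M] (g : DualVertex K → DualFace K → M) :
    ∏ v : DualVertex K, ∏ f : DualFace K with f.1 ⊆ v.1, g v f =
      ∏ f : DualFace K, ∏ v : DualVertex K with f.1 ⊆ v.1, g v f :=
  Finset.prod_comm' fun e f => by simp

lemma faceFactor_eq {p : ℝ} (hp : 0 < p) (f : DualFace K) (r : DualEdge K → ℝ)
    (x : c.HypConfig) : c.faceFactor f r x p =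
      (∏ v : DualVertex K with f.1 ⊆ v.1, Real.sin (p * c.phi f v (x v)) / p) *
        (∏ e : DualEdge K with f.1 ⊆ e.1, Real.sin (p * r e) / p) * p ^ 2 := by
  rw [faceFactor, Finset.prod_div_distrib, Finset.prod_div_distrib, Finset.prod_const,
    Finset.prod_const, zpow_sub₀ hp.ne', zpow_add₀ hp.ne', zpow_natCast, zpow_natCast, degV, degE]
  have h2 : p ^ (2 : ℤ) = p ^ 2 := by norm_cast
  rw [h2]
  field_simp

/-- Incidences `(e, f)` and `(v, f)` are regrouped by face: each brings one sine and one `1 / p f`,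
and the measure brings `p f ^ 2`. Zeros of `sinh` need no exclusion, as division by zero gives zero
on both sides. -/
lemma totalIntegrand_eq {p : DualFace K → ℝ} (hp : ∀ f, 0 < p f) (r : DualEdge K → ℝ)
    (x : c.HypConfig) :
    c.totalIntegrand p r x = c.sinhFactor r x * ∏ f, c.faceFactor f r x (p f) := by
  have h1 : ∏ e : DualEdge K, 2 / (π * ∏ f : DualFace K with f.1 ⊆ e.1, p f) *
      eyeIntegrand p e (r e) = (∏ e, 2 / (π * Real.sinh (r e) ^ 2)) *
        ∏ f : DualFace K, ∏ e : DualEdge K with f.1 ⊆ e.1, Real.sin (p f * r e) / p f := by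
    rw [← prod_edges_comm (fun e f => Real.sin (p f * r e) / p f), ← Finset.prod_mul_distrib]
    refine Finset.prod_congr rfl fun e _ => ?_
    rw [eyeIntegrand, Finset.prod_div_distrib, div_mul_div_comm, div_mul_div_comm]
    congr 1
    ring
  have h2 : ∏ v, c.vertexIntegrand p v (x v) =
      (∏ v, ∏ f : DualFace K with f.1 ⊆ v.1, 1 / Real.sinh (c.phi f v (x v))) *
        ∏ f : DualFace K, ∏ v : DualVertex K with f.1 ⊆ v.1,
          Real.sin (p f * c.phi f v (x v)) / p f := by
    rw [← prod_vertices_comm (fun v f => Real.sin (p f * c.phi f v (x v)) / p f),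
      ← Finset.prod_mul_distrib]
    refine Finset.prod_congr rfl fun v _ => ?_
    rw [vertexIntegrand, ← Finset.prod_mul_distrib]
    refine Finset.prod_congr rfl fun f _ => ?_
    rw [kernel, ← phi, div_mul_div_comm, one_mul, mul_comm (p f) (Real.sinh _)]
  rw [totalIntegrand, h1, h2, sinhFactor,
    Finset.prod_congr rfl fun f _ => c.faceFactor_eq (hp f) f r x, Finset.prod_mul_distrib,
    Finset.prod_mul_distrib]
  simp only [faceAmplitude, Finset.prod_const_one]
  ring

/-! ## Absolute integrability -/

/-- The majorant of the vertex integrand. -/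
def vertexMajorant (v : DualVertex K) (x : c.VertexConfig v) : ℝ :=
  ∏ f : DualFace K with f.1 ⊆ v.1, gauge (c.phi f v x) / Real.sinh (c.phi f v x)

lemma integrable_vertexMajorant (v : DualVertex K) :
    Integrable (c.vertexMajorant v) (c.vertexMeasure v) := by
  have h := (c.integrable_prod_majorant v).const_mul
    (∏ _f : DualFace K with _f.1 ⊆ v.1, (40 : ℝ))
  have hm : Measurable (c.vertexMajorant v) := by
    unfold vertexMajorant
    exact Finset.measurable_prod _ fun f _ => (measurable_gauge.comp (c.measurable_phi f v)).div
      (Real.measurable_sinh.comp (c.measurable_phi f v))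
  refine h.mono' hm.aestronglyMeasurable (Filter.Eventually.of_forall fun x => ?_)
  have hx : 0 ≤ c.vertexMajorant v x := Finset.prod_nonneg fun f _ => gauge_div_sinh_nonneg _ _
  rw [Real.norm_of_nonneg hx, ← Finset.prod_mul_distrib]
  exact Finset.prod_le_prod (fun f _ => gauge_div_sinh_nonneg _ _)
    fun f _ => gauge_div_sinh_le _ _

lemma measurable_vertexIntegrand (v : DualVertex K) {α : Type*} [MeasurableSpace α]
    {p : α → DualFace K → ℝ} {x : α → c.VertexConfig v} (hp : Measurable p) (hx : Measurable x) :
    Measurable fun z => c.vertexIntegrand (p z) v (x z) := by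
  unfold vertexIntegrand
  refine Finset.measurable_prod _ fun f _ => ?_
  have h1 : Measurable fun z => p z f := (measurable_pi_apply f).comp hp
  have h2 : Measurable fun z => c.phi f v (x z) := (c.measurable_phi f v).comp hx
  exact (Real.measurable_sin.comp (h1.mul h2)).div (h1.mul (Real.measurable_sinh.comp h2))

lemma integrable_vertexIntegrand {p : DualFace K → ℝ} (hp : ∀ f, 0 < p f) (v : DualVertex K) :
    Integrable (c.vertexIntegrand p v) (c.vertexMeasure v) := by
  have hm : Measurable (c.vertexIntegrand p v) :=
    c.measurable_vertexIntegrand v measurable_const measurable_id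
  refine (c.integrable_vertexMajorant v).mono' hm.aestronglyMeasurable
    (Filter.Eventually.of_forall fun x => ?_)
  rw [Real.norm_eq_abs, vertexIntegrand, Finset.abs_prod]
  exact Finset.prod_le_prod (fun _ _ => abs_nonneg _) fun f _ => abs_kernel_le (hp f) _ _

end Choices

variable [Fintype V]

lemma measurable_eyeIntegrand (e : DualEdge K) {α : Type*} [MeasurableSpace α]
    {p : α → DualFace K → ℝ} {r : α → ℝ} (hp : Measurable p) (hr : Measurable r) :
    Measurable fun z => eyeIntegrand (p z) e (r z) := by
  unfold eyeIntegrand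
  refine Measurable.div (Finset.measurable_prod _ fun f _ => ?_)
    ((Real.measurable_sinh.comp hr).pow_const 2)
  exact Real.measurable_sin.comp (((measurable_pi_apply f).comp hp).mul hr)

lemma integrableOn_eyeIntegrand {p : DualFace K → ℝ} (hp : ∀ f, 0 < p f) (e : DualEdge K) :
    IntegrableOn (eyeIntegrand p e) (Set.Ioi 0) := by
  have hm : Measurable (eyeIntegrand p e) :=
    measurable_eyeIntegrand e measurable_const measurable_id
  -- The factor `π / 2` cancels the normalization built into `eyeMajorant`.
  have hb := integrableOn_eyeMajorant.const_mul
    ((∏ f : DualFace K with f.1 ⊆ e.1, p f) * (π / 2))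
  refine Integrable.mono' hb hm.aestronglyMeasurable ?_
  refine (ae_restrict_iff' measurableSet_Ioi).2 (Filter.Eventually.of_forall fun r hr => ?_)
  have hr0 : 0 < r := hr
  have h : ∏ f : DualFace K with f.1 ⊆ e.1, |Real.sin (p f * r)| ≤
      (∏ f : DualFace K with f.1 ⊆ e.1, p f) * gauge r ^ 4 := by
    have hc : gauge r ^ 4 = ∏ _f : DualFace K with _f.1 ⊆ e.1, gauge r := by
      rw [Finset.prod_const, card_faces_of_dualEdge]
    rw [hc, ← Finset.prod_mul_distrib]
    refine Finset.prod_le_prod (fun _ _ => abs_nonneg _) fun f _ => ?_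
    have := abs_sin_le_mul_gauge (hp f).le r
    rwa [abs_of_pos hr0] at this
  have hs : 0 < Real.sinh r ^ 2 := pow_pos (Real.sinh_pos_iff.2 hr0) 2
  rw [Real.norm_eq_abs, eyeIntegrand, abs_div, Finset.abs_prod, abs_of_pos hs]
  refine (div_le_div_of_nonneg_right h hs.le).trans_eq ?_
  rw [eyeMajorant]
  have := Real.pi_ne_zero
  field_simp

instance (ι : Type*) [Fintype ι] : SigmaFinite (posMeasure ι) := by
  unfold posMeasure
  infer_instance

lemma ae_posMeasure (ι : Type*) [Fintype ι] : ∀ᵐ p ∂posMeasure ι, ∀ i, 0 < p i := by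
  rw [posMeasure, ← Measure.restrict_pi_pi]
  filter_upwards [ae_restrict_mem (MeasurableSet.univ_pi fun _ => measurableSet_Ioi)] with p hp i
  exact hp i trivial

namespace Choices

variable (c : Choices K)

instance (v : DualVertex K) : SigmaFinite (c.vertexMeasure v) := by
  unfold vertexMeasure
  infer_instance

instance : SigmaFinite c.hypConfigMeasure := by
  unfold hypConfigMeasure
  infer_instance

/-- After each face factor is bounded, the gauges return to where their arguments live: four `gauge
(r e)` to every edge, and one `gauge φ` to every kernel at a vertex. No variable is then shared
between the spin, edge and vertex parts of the bound. -/
lemma abs_totalIntegrand_le (hdeg : ∀ f : DualFace K, 6 ≤ degV f + degE f)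
    {p : DualFace K → ℝ} (hp : ∀ f, 0 < p f) {r : DualEdge K → ℝ} (hr : ∀ e, 0 < r e)
    (x : c.HypConfig) :
    |c.totalIntegrand p r x| ≤ (∏ f, 2 * (1 + p f ^ 2)⁻¹) *
      ((∏ e, eyeMajorant (r e)) * ∏ v, c.vertexMajorant v (x v)) := by
  have hs : |c.sinhFactor r x| = c.sinhFactor r x := by
    refine abs_of_nonneg (mul_nonneg (Finset.prod_nonneg fun e _ => by positivity)
      (Finset.prod_nonneg fun v _ => Finset.prod_nonneg fun f _ => ?_))
    exact div_nonneg zero_le_one (Real.sinh_nonneg_iff.2 (c.phi_nonneg _ _ _))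
  rw [c.totalIntegrand_eq hp, abs_mul, Finset.abs_prod, hs]
  have h1 : ∏ f, |c.faceFactor f r x (p f)| ≤
      ∏ f, c.faceGauge f r x * (2 * (1 + p f ^ 2)⁻¹) :=
    Finset.prod_le_prod (fun _ _ => abs_nonneg _)
      fun f _ => c.abs_faceFactor_le (hdeg f) r x (hp f)
  refine (mul_le_mul_of_nonneg_left h1 (hs ▸ abs_nonneg _)).trans_eq ?_
  have h2 : ∏ f, c.faceGauge f r x =
      (∏ v, ∏ f : DualFace K with f.1 ⊆ v.1, gauge (c.phi f v (x v))) *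
        ∏ e, gauge (r e) ^ 4 := by
    simp only [faceGauge]
    rw [Finset.prod_mul_distrib, ← prod_vertices_comm (fun v f => gauge (c.phi f v (x v))),
      ← prod_edges_comm (fun e _ => gauge |r e|)]
    congr 1
    refine Finset.prod_congr rfl fun e _ => ?_
    rw [Finset.prod_const, card_faces_of_dualEdge, abs_of_pos (hr e)]
  rw [Finset.prod_mul_distrib, h2, sinhFactor]
  simp only [eyeMajorant, vertexMajorant, Finset.prod_mul_distrib, Finset.prod_div_distrib,
    Finset.prod_const_one]
  ring

lemma measurable_totalIntegrand :
    Measurable fun z : (DualFace K → ℝ) × (DualEdge K → ℝ) × c.HypConfig =>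
      c.totalIntegrand z.1 z.2.1 z.2.2 := by
  unfold totalIntegrand
  have hp : ∀ f, Measurable fun z : (DualFace K → ℝ) × (DualEdge K → ℝ) × c.HypConfig => z.1 f :=
    fun f => (measurable_pi_apply f).comp measurable_fst
  refine Measurable.mul (Measurable.mul (Measurable.mul ?_ ?_) ?_) ?_
  · simp only [faceAmplitude]
    exact measurable_const
  · refine Finset.measurable_prod _ fun e _ => Measurable.mul ?_ ?_
    · exact measurable_const.div
        (measurable_const.mul (Finset.measurable_prod _ fun f _ => hp f))
    · exact measurable_eyeIntegrand e measurable_fst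
        ((measurable_pi_apply e).comp (measurable_fst.comp measurable_snd))
  · exact Finset.measurable_prod _ fun v _ => c.measurable_vertexIntegrand v measurable_fst
      ((measurable_pi_apply v).comp (measurable_snd.comp measurable_snd))
  · exact Finset.measurable_prod _ fun f _ => (hp f).pow_const 2

lemma integrable_totalIntegrand (hdeg : ∀ f : DualFace K, 6 ≤ degV f + degE f) :
    Integrable (fun z : (DualFace K → ℝ) × (DualEdge K → ℝ) × c.HypConfig =>
      c.totalIntegrand z.1 z.2.1 z.2.2)
      ((posMeasure (DualFace K)).prod ((posMeasure (DualEdge K)).prod c.hypConfigMeasure)) := by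
  have h1 : Integrable (fun p : DualFace K → ℝ => ∏ f, 2 * (1 + p f ^ 2)⁻¹)
      (posMeasure (DualFace K)) :=
    Integrable.fintype_prod (f := fun _ (t : ℝ) => 2 * (1 + t ^ 2)⁻¹)
      fun _ => (integrable_inv_one_add_sq.const_mul 2).integrableOn
  have h2 : Integrable (fun r : DualEdge K → ℝ => ∏ e, eyeMajorant (r e))
      (posMeasure (DualEdge K)) :=
    Integrable.fintype_prod (f := fun _ => eyeMajorant) fun _ => integrableOn_eyeMajorant
  have h3 : Integrable (fun x : c.HypConfig => ∏ v, c.vertexMajorant v (x v))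
      c.hypConfigMeasure :=
    Integrable.fintype_prod_dep fun v => c.integrable_vertexMajorant v
  refine (h1.mul_prod (h2.mul_prod h3)).mono' c.measurable_totalIntegrand.aestronglyMeasurable ?_
  filter_upwards [Measure.quasiMeasurePreserving_fst.ae (ae_posMeasure (DualFace K)),
    Measure.quasiMeasurePreserving_snd.ae
      (Measure.quasiMeasurePreserving_fst.ae (ae_posMeasure (DualEdge K)))] with z hp hr
  exact c.abs_totalIntegrand_le hdeg hp hr z.2.2

/-! ## Fubini -/

/-- Valid for every `r` and `x`, with no integrability needed: the integral of a product of
one-variable functions is always the product of the integrals. The same holds for the two lemmas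
that follow. -/
lemma integral_totalIntegrand_left (r : DualEdge K → ℝ) (x : c.HypConfig) :
    ∫ p, c.totalIntegrand p r x ∂posMeasure (DualFace K) = c.faceFactoredIntegrand r x := by
  have h : ∫ p, c.totalIntegrand p r x ∂posMeasure (DualFace K) =
      ∫ p : DualFace K → ℝ, c.sinhFactor r x * ∏ f, c.faceFactor f r x (p f)
        ∂posMeasure (DualFace K) := by
    refine integral_congr_ae ?_
    filter_upwards [ae_posMeasure (DualFace K)] with p hp
    exact c.totalIntegrand_eq hp r x
  rw [h, integral_const_mul, posMeasure,
    integral_fintype_prod_eq_prod (fun f => c.faceFactor f r x), faceFactoredIntegrand]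

lemma integral_abs_totalIntegrand_left (r : DualEdge K → ℝ) (x : c.HypConfig) :
    ∫ p, |c.totalIntegrand p r x| ∂posMeasure (DualFace K) =
      c.absFaceFactoredIntegrand r x := by
  have h : ∫ p, |c.totalIntegrand p r x| ∂posMeasure (DualFace K) =
      ∫ p : DualFace K → ℝ, |c.sinhFactor r x| * ∏ f, |c.faceFactor f r x (p f)|
        ∂posMeasure (DualFace K) := by
    refine integral_congr_ae ?_
    filter_upwards [ae_posMeasure (DualFace K)] with p hp
    rw [c.totalIntegrand_eq hp r x, abs_mul, Finset.abs_prod]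
  rw [h, integral_const_mul, posMeasure,
    integral_fintype_prod_eq_prod (fun f t => |c.faceFactor f r x t|), absFaceFactoredIntegrand]

lemma integral_totalIntegrand_right (p : DualFace K → ℝ) :
    ∫ y : (DualEdge K → ℝ) × c.HypConfig, c.totalIntegrand p y.1 y.2
      ∂((posMeasure (DualEdge K)).prod c.hypConfigMeasure) = c.spinIntegrand p := by
  have h1 : ∫ r : DualEdge K → ℝ, ∏ e, 2 / (π * ∏ f : DualFace K with f.1 ⊆ e.1, p f) *
      eyeIntegrand p e (r e) ∂posMeasure (DualEdge K) = ∏ e, edgeAmplitude p e := by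
    rw [posMeasure, integral_fintype_prod_eq_prod (fun (e : DualEdge K) (t : ℝ) =>
      2 / (π * ∏ f : DualFace K with f.1 ⊆ e.1, p f) * eyeIntegrand p e t)]
    exact Finset.prod_congr rfl fun e _ => integral_const_mul _ _
  have h2 : ∫ x : c.HypConfig, ∏ v, c.vertexIntegrand p v (x v) ∂c.hypConfigMeasure =
      ∏ v, c.vertexAmplitude p v :=
    integral_fintype_prod_eq_prod (fun v => c.vertexIntegrand p v)
  have h3 := integral_prod_mul (μ := posMeasure (DualEdge K)) (ν := c.hypConfigMeasure)
    (fun r : DualEdge K → ℝ => ∏ e, 2 / (π * ∏ f : DualFace K with f.1 ⊆ e.1, p f) *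
      eyeIntegrand p e (r e)) (fun x : c.HypConfig => ∏ v, c.vertexIntegrand p v (x v))
  rw [h1, h2] at h3
  rw [spinIntegrand, mul_assoc (∏ f, faceAmplitude (p f)), ← h3, ← integral_const_mul,
    ← integral_mul_const]
  refine integral_congr_ae (Filter.Eventually.of_forall fun y => ?_)
  simp only [totalIntegrand, mul_assoc]

end Choices

end SpinFoam

end

theorem mainTheorem2 {V : Type*} [Fintype V] [DecidableEq V] (K : AbstractSimplicialComplex V)
    (hK : SpinFoam.IsClosedFourManifold K) :
    -- degrees of the dual faces, and the exponents of the edge variables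
    (∀ f : SpinFoam.DualFace K, 6 ≤ SpinFoam.degV f + SpinFoam.degE f) ∧
    (∀ e : SpinFoam.DualEdge K, 2 ≤ SpinFoam.alpha e) ∧
    -- for every choice made in regularizing and writing down the vertex amplitudes
    ∀ c : SpinFoam.Choices K,
      -- absolute integrability of the face factored form
      (∀ f r x, IntegrableOn (c.faceFactor f r x) (Set.Ioi 0)) ∧
      Integrable (fun z : (SpinFoam.DualEdge K → ℝ) × c.HypConfig =>
          c.absFaceFactoredIntegrand z.1 z.2)
        ((SpinFoam.posMeasure (SpinFoam.DualEdge K)).prod c.hypConfigMeasure) ∧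
      Integrable (fun z : (SpinFoam.DualEdge K → ℝ) × c.HypConfig =>
          c.faceFactoredIntegrand z.1 z.2)
        ((SpinFoam.posMeasure (SpinFoam.DualEdge K)).prod c.hypConfigMeasure) ∧
      -- absolute integrability in all variables together
      Integrable
        (fun z : (SpinFoam.DualFace K → ℝ) × (SpinFoam.DualEdge K → ℝ) × c.HypConfig =>
          c.totalIntegrand z.1 z.2.1 z.2.2)
        ((SpinFoam.posMeasure (SpinFoam.DualFace K)).prod
          ((SpinFoam.posMeasure (SpinFoam.DualEdge K)).prod c.hypConfigMeasure)) ∧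
      -- the amplitudes and the partition function are given by convergent integrals
      (∀ p : SpinFoam.DualFace K → ℝ, (∀ f, 0 < p f) →
        (∀ e, IntegrableOn (SpinFoam.eyeIntegrand p e) (Set.Ioi 0)) ∧
        ∀ v, Integrable (c.vertexIntegrand p v) (c.vertexMeasure v)) ∧
      Integrable c.spinIntegrand (SpinFoam.posMeasure (SpinFoam.DualFace K)) ∧
      -- face factoring is justified
      c.partitionFunction = c.faceFactoredPartitionFunction := by
  have hdeg := SpinFoam.six_le_degV_add_degE hK
  refine ⟨hdeg, SpinFoam.two_le_alpha hK, fun c => ?_⟩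
  -- Joint integrability yields by Fubini the integrability of both partial integrals, over the
  -- spins and over `(r, x)`, as well as the exchange of the two orders. Integrating the norm over
  -- the spins gives the absolute version.
  have hI := c.integrable_totalIntegrand hdeg
  have hff : Integrable (fun z : (SpinFoam.DualEdge K → ℝ) × c.HypConfig =>
      c.faceFactoredIntegrand z.1 z.2)
      ((SpinFoam.posMeasure (SpinFoam.DualEdge K)).prod c.hypConfigMeasure) :=
    hI.integral_prod_right.congr
      (Filter.Eventually.of_forall fun z => c.integral_totalIntegrand_left z.1 z.2)
  refine ⟨fun f r x => c.integrableOn_faceFactor (hdeg f) r x, ?_, hff, hI, fun p hp =>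
    ⟨SpinFoam.integrableOn_eyeIntegrand hp, c.integrable_vertexIntegrand hp⟩, ?_, ?_⟩
  · exact hI.norm.integral_prod_right.congr
      (Filter.Eventually.of_forall fun z => c.integral_abs_totalIntegrand_left z.1 z.2)
  · exact hI.integral_prod_left.congr
      (Filter.Eventually.of_forall fun p => c.integral_totalIntegrand_right p)
  · calc c.partitionFunction
        = ∫ p, ∫ y : (SpinFoam.DualEdge K → ℝ) × c.HypConfig, c.totalIntegrand p y.1 y.2
            ∂((SpinFoam.posMeasure (SpinFoam.DualEdge K)).prod c.hypConfigMeasure)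
            ∂SpinFoam.posMeasure (SpinFoam.DualFace K) := by
          simp only [c.integral_totalIntegrand_right]
          rfl
      _ = ∫ y : (SpinFoam.DualEdge K → ℝ) × c.HypConfig, c.faceFactoredIntegrand y.1 y.2
            ∂((SpinFoam.posMeasure (SpinFoam.DualEdge K)).prod c.hypConfigMeasure) := by
          rw [integral_integral_swap hI]
          simp only [c.integral_totalIntegrand_left]
      _ = c.faceFactoredPartitionFunction := integral_prod _ hff
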